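/- Let $W_Q,W_K\in\mathbb R^{m\times d}$ and $W_V\in\mathbb R^{d\times d}$ satisfy $W_K^\top W_Q=W_Q^\top W_K=-W_V$. Put $c(x,x')=(W_Qx)^\top W_Kx'$ and $k^0=e^{c}$ on $\mathbb R^d\times\mathbb R^d$. For a probability measure $\mu$ on $\mathbb R^d$ let $k^1(x,x')=k^0(x,x')/\int k^0(x,y)\,d\mu(y)$, and let $k^\infty$ be the pointwise limit, as $l\to\infty$, of Sinkhorn's iterations started at $k^0$: $k^{l+1}(x,x')=k^l(x,x')/\int k^l(x,y)\,d\mu(y)$ for $l$ even and $k^{l+1}(x,x')=k^l(x,x')/\int k^l(y,x')\,d\mu(y)$ for $l$ odd. For $p\in\{0,1,\infty\}$ let $T^p_\mu(x)=\int k^p(x,x')\,W_Vx'\,d\mu(x')$ be the attention map; the PDE generated by $k^p$ is the continuity equation $\partial_t\mu+\mathrm{div}(\mu T^p_\mu)=0$. Let $$\mathcal F^0(\mu)=\tfrac12\int k^0\,d(\mu\otimes\mu),\qquad \mathcal F^\infty(\mu)=-\tfrac12\int k^\infty\log\frac{k^\infty}{k^0}\,d(\mu\otimes\mu).$$ A first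 variation of $\mathcal F$ at $\mu$ is a function $\varphi$, integrable with respect to $\mu$ and to all compactly supported probability measures, such that $\frac{d}{d\varepsilon}\mathcal F(\mu+\varepsilon\rho)|_{\varepsilon=0^+}=\int\varphi\,d\rho$ for every $\rho=\nu-\mu$ with $\nu$ a compactly supported probability measure; it is unique up to a constant, and $\nabla_W\mathcal F(\mu):=\nabla\varphi$ if $\varphi$ is differentiable. Solutions of a continuity equation are narrowly continuous curves of probability measures on an interval $[0,\tau)$ that satisfy it in the weak sense; a Wasserstein gradient flow of $\mathcal F$ is a solution of $\partial_t\mu+\mathrm{div}(\mu v)=0$ with $v=-\nabla_W\mathcal F(\mu)$. Then: 1. If $\int k^0(x,x')\,d\mu(x')<\infty$ for all $x$ and $\int k^0\,d(\mu\otimes\mu)<\infty$, then the integral $T^0_\mu(x)$ converges for all $x$, $\nabla_W\mathcal F^0(\mu)$ exists, and $T^0_\mu=-\nabla_W\mathcal F^0(\mu)$. Hence a curve of such measures solves the PDE generated by $k^0$ if and only if it is a Wasserstein gradient flow of $\mathcal F^0$. 2. If $\int k^0(x,x')\,d\mu(x')<\infty$ for all $x$, then the integral $T^1_\mu(x)$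 converges for all $x$, $\log\int k^0(\cdot,x')\,d\mu(x')$ is differentiable, and $T^1_\mu=-\nabla\big[\log\int k^0(\cdot,x')\,d\mu(x')\big]$. Hence a curve of such measures solves the PDE generated by $k^1$ if and only if it solves the continuity equation with velocity field $-\nabla\big[\log\int k^0(\cdot,x')\,d\mu(x')\big]$. 3. If $\mu$ has compact support, then Sinkhorn's iterations converge at every $(x,x')\in\mathbb R^d\times\mathbb R^d$, the integrals $T^\infty_\mu(x)$ (for all $x$) and $\mathcal F^\infty(\mu)$ converge, $\nabla_W\mathcal F^\infty(\mu)$ exists, and $T^\infty_\mu=-\nabla_W\mathcal F^\infty(\mu)$. Hence a curve of compactly supported measures solves the PDE generated by $k^\infty$ if and only if it is a Wasserstein gradient flow of $\mathcal F^\infty$; that is, Sinkformers are Wasserstein gradient flows. -/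

import Mathlib

open MeasureTheory Filter Set Topology
open scoped Gradient ContDiff

namespace Sinkformer

noncomputable section

/-! ### Attention kernels with respect to a measure -/

/-- The SoftMax normalisation of a positive kernel `k` with respect to `μ`. -/
def softMaxKernel {X : Type*} [MeasurableSpace X] (k : X → X → ℝ) (μ : Measure X) (x x' : X) : ℝ :=
  k x x' / ∫ y, k x y ∂μ

/-- Sinkhorn's iterations started at the kernel `k`: row normalisation at even steps, column
normalisation at odd steps, both with respect to `μ`. -/
def sinkhornIter {X : Type*} [MeasurableSpace X] (k : X → X → ℝ) (μ : Measure X) :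
    ℕ → X → X → ℝ
  | 0 => k
  | l + 1 => fun x x' =>
      if Even l then sinkhornIter k μ l x x' / ∫ y, sinkhornIter k μ l x y ∂μ
      else sinkhornIter k μ l x x' / ∫ y, sinkhornIter k μ l y x' ∂μ

/-- The pointwise limit of Sinkhorn's iterations. -/
def sinkhornKernel {X : Type*} [MeasurableSpace X] (k : X → X → ℝ) (μ : Measure X) (x x' : X) : ℝ :=
  limUnder atTop (fun l => sinkhornIter k μ l x x')

/-- The cost `c(x, x') = (W_Q x)ᵀ W_K x'`. -/
def cost {m d : ℕ} (WQ WK : Matrix (Fin m) (Fin d) ℝ) (x x' : EuclideanSpace ℝ (Fin d)) : ℝ :=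
  inner ℝ (Matrix.toEuclideanLin WQ x) (Matrix.toEuclideanLin WK x')

/-- The unnormalised kernel `k⁰ = exp c`. -/
def kZero {m d : ℕ} (WQ WK : Matrix (Fin m) (Fin d) ℝ) (x x' : EuclideanSpace ℝ (Fin d)) : ℝ :=
  Real.exp (cost WQ WK x x')

/-- The SoftMax kernel `k¹`. -/
def kOne {m d : ℕ} (WQ WK : Matrix (Fin m) (Fin d) ℝ)
    (μ : Measure (EuclideanSpace ℝ (Fin d))) (x x' : EuclideanSpace ℝ (Fin d)) : ℝ :=
  softMaxKernel (kZero WQ WK) μ x x'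

/-- The Sinkhorn kernel `k^∞`. -/
def kInf {m d : ℕ} (WQ WK : Matrix (Fin m) (Fin d) ℝ)
    (μ : Measure (EuclideanSpace ℝ (Fin d))) (x x' : EuclideanSpace ℝ (Fin d)) : ℝ :=
  sinkhornKernel (kZero WQ WK) μ x x'

/-- The attention map `T_μ(x) = ∫ k(x, x') W_V x' dμ(x')` of a kernel `k`. -/
def attentionMap {d : ℕ} (WV : Matrix (Fin d) (Fin d) ℝ)
    (k : EuclideanSpace ℝ (Fin d) → EuclideanSpace ℝ (Fin d) → ℝ)
    (μ : Measure (EuclideanSpace ℝ (Fin d))) (x : EuclideanSpace ℝ (Fin d)) :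
    EuclideanSpace ℝ (Fin d) :=
  ∫ x', k x x' • Matrix.toEuclideanLin WV x' ∂μ

/-- The integral defining the attention map of `k` at `μ` converges at every point. -/
def AttentionConverges {d : ℕ} (WV : Matrix (Fin d) (Fin d) ℝ)
    (k : EuclideanSpace ℝ (Fin d) → EuclideanSpace ℝ (Fin d) → ℝ)
    (μ : Measure (EuclideanSpace ℝ (Fin d))) : Prop :=
  ∀ x, Integrable (fun x' => k x x' • Matrix.toEuclideanLin WV x') μ

/-! ### The energies -/

/-- `F⁰(μ) = ½ ∫ k⁰ d(μ ⊗ μ)`. -/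
def energyZero {m d : ℕ} (WQ WK : Matrix (Fin m) (Fin d) ℝ)
    (μ : Measure (EuclideanSpace ℝ (Fin d))) : ℝ :=
  (1 / 2) * ∫ p, kZero WQ WK p.1 p.2 ∂(μ.prod μ)

/-- The integrand `k^∞ log (k^∞ / k⁰)` of `F^∞`. -/
def entropyDensity {m d : ℕ} (WQ WK : Matrix (Fin m) (Fin d) ℝ)
    (μ : Measure (EuclideanSpace ℝ (Fin d)))
    (p : EuclideanSpace ℝ (Fin d) × EuclideanSpace ℝ (Fin d)) : ℝ :=
  kInf WQ WK μ p.1 p.2 * Real.log (kInf WQ WK μ p.1 p.2 / kZero WQ WK p.1 p.2)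

/-- `F^∞(μ) = -½ ∫ k^∞ log (k^∞ / k⁰) d(μ ⊗ μ)`. -/
def energyInf {m d : ℕ} (WQ WK : Matrix (Fin m) (Fin d) ℝ)
    (μ : Measure (EuclideanSpace ℝ (Fin d))) : ℝ :=
  -(1 / 2) * ∫ p, entropyDensity WQ WK μ p ∂(μ.prod μ)

/-! ### First variations, Wasserstein gradients, continuity equations -/

/-- The measure `μ` is carried by a compact set. -/
def CompactlySupported {d : ℕ} (μ : Measure (EuclideanSpace ℝ (Fin d))) : Prop :=
  ∃ K : Set (EuclideanSpace ℝ (Fin d)), IsCompact K ∧ μ Kᶜ = 0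

/-- Measures for which `F⁰(μ)` and `∫ k⁰(x, ·) dμ`, for every `x`, are finite. -/
def FiniteEnergyZero {m d : ℕ} (WQ WK : Matrix (Fin m) (Fin d) ℝ)
    (μ : Measure (EuclideanSpace ℝ (Fin d))) : Prop :=
  (∀ x, Integrable (fun x' => kZero WQ WK x x') μ) ∧
    Integrable (fun p : EuclideanSpace ℝ (Fin d) × EuclideanSpace ℝ (Fin d) =>
      kZero WQ WK p.1 p.2) (μ.prod μ)

/-- `φ` is a first variation of `F` at the probability measure `μ`: the derivative of
`ε ↦ F (μ + ε ρ)` at `0⁺` is `∫ φ dρ` for all perturbations `ρ = ν - μ`, with `ν` a compactly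
supported probability measure. -/
def HasFirstVariation {d : ℕ} (F : Measure (EuclideanSpace ℝ (Fin d)) → ℝ)
    (μ : Measure (EuclideanSpace ℝ (Fin d))) (φ : EuclideanSpace ℝ (Fin d) → ℝ) : Prop :=
  Integrable φ μ ∧
    ∀ ν : Measure (EuclideanSpace ℝ (Fin d)), IsProbabilityMeasure ν → CompactlySupported ν →
      Integrable φ ν ∧
      HasDerivWithinAt (fun ε : ℝ => F (ENNReal.ofReal (1 - ε) • μ + ENNReal.ofReal ε • ν))
        (∫ x, φ x ∂ν - ∫ x, φ x ∂μ) (Ici 0) 0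

/-- `w = ∇_W F(μ)`: the field `w` is the gradient of a first variation of `F` at `μ`.
(First variations at `μ` differ by constants, as Dirac masses are allowed for `ν`.) -/
def HasWassersteinGradient {d : ℕ} (F : Measure (EuclideanSpace ℝ (Fin d)) → ℝ)
    (μ : Measure (EuclideanSpace ℝ (Fin d)))
    (w : EuclideanSpace ℝ (Fin d) → EuclideanSpace ℝ (Fin d)) : Prop :=
  ∃ φ : EuclideanSpace ℝ (Fin d) → ℝ, HasFirstVariation F μ φ ∧ ∀ x, HasGradientAt φ (w x) x

/-- `∂ₜ μ + div (μ v) = 0` on the time interval `[0, τ)`, in the weak sense, for a narrowly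
continuous curve of probability measures `μ` and a time-dependent vector field `v`. -/
structure SolvesContinuityEquation {d : ℕ} (τ : ℝ)
    (μ : ℝ → ProbabilityMeasure (EuclideanSpace ℝ (Fin d)))
    (v : ℝ → EuclideanSpace ℝ (Fin d) → EuclideanSpace ℝ (Fin d)) : Prop where
  continuousOn : ContinuousOn μ (Ico 0 τ)
  integrable : ∀ᵐ t ∂(volume.restrict (Ico 0 τ)),
    Integrable (v t) (μ t : Measure (EuclideanSpace ℝ (Fin d)))
  intervalIntegrable_norm : ∀ t ∈ Ico 0 τ, IntervalIntegrable
    (fun s => ∫ x, ‖v s x‖ ∂(μ s : Measure (EuclideanSpace ℝ (Fin d)))) volume 0 t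
  weak : ∀ ψ : EuclideanSpace ℝ (Fin d) → ℝ, ContDiff ℝ ∞ ψ → HasCompactSupport ψ →
    ∀ t ∈ Ico 0 τ,
      IntervalIntegrable
        (fun s => ∫ x, inner ℝ (∇ ψ x) (v s x) ∂(μ s : Measure (EuclideanSpace ℝ (Fin d))))
        volume 0 t ∧
      ∫ x, ψ x ∂(μ t : Measure (EuclideanSpace ℝ (Fin d)))
          - ∫ x, ψ x ∂(μ 0 : Measure (EuclideanSpace ℝ (Fin d)))
        = ∫ s in (0 : ℝ)..t,
            ∫ x, inner ℝ (∇ ψ x) (v s x) ∂(μ s : Measure (EuclideanSpace ℝ (Fin d)))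

/-- The Wasserstein gradient flow of `F`: the continuity equation with velocity field
`v = -∇_W F(μ)`. -/
def IsWassersteinGradientFlow {d : ℕ} (F : Measure (EuclideanSpace ℝ (Fin d)) → ℝ) (τ : ℝ)
    (μ : ℝ → ProbabilityMeasure (EuclideanSpace ℝ (Fin d))) : Prop :=
  ∃ v : ℝ → EuclideanSpace ℝ (Fin d) → EuclideanSpace ℝ (Fin d),
    (∀ t ∈ Ico 0 τ, HasWassersteinGradient F (μ t) (fun x => -v t x)) ∧
      SolvesContinuityEquation τ μ v

end

end Sinkformer

open Sinkformer

/-! The hypothesis on the matrices makes `kZero` symmetric and gives c(x, x') = ⟨x, -W_V x'⟩.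
Differentiating under the integral therefore yields ∇∫ k⁰(·, y) w(y) dμ = -∫ k⁰(·, y) w(y) W_V y dμ
for each weight w ≥ 0 with finite integrals (`hasGradientAt_integral_exp`). With w = 1 this is -T⁰,
and the gradient of the logarithm is -T¹. Since F⁰ is quadratic in μ and the kernel is symmetric,
its first variation is ∫ k⁰(·, y) dμ.

For the Sinkhorn kernel, let L_μ w = ∫ k⁰(·, y) w(y) dμ(y), and let w > 0 solve w · L_μ w = 1 on the
whole space. Then k^∞(x, x') = k⁰(x, x') w(x) w(x'), and T^∞ = -∇ log L_μ w = ∇ log w. It remains to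
see that -log w is the first variation of F^∞.

Existence of w and convergence rest on a projective contraction: on a compact set carrying μ, L_μ
shrinks the multiplicative oscillation R of u/v to 1 + (1 - C⁻²)(R - 1), where C bounds the
oscillation of the kernel (`RatioBound.integralOp_integralOp`). Inversion preserves R, so u ↦ 1/L_μ
u contracts as well. By symmetry, Sinkhorn's iterates are products of two consecutive iterates of
this map.

For the variation, F^∞(μ) = -∫ log w dμ, and w maximises 2∫ log u dμ - ∫ u L_μ u dμ + 1
(`IsScaling.integral_log_ge`). Testing the problem for (1 - ε)μ + εν with w, and the problem for μ
with the scaling v of the mixture, pinches the energy between bounds that agree up to O(ε²), as in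
an envelope theorem. The upper bound also needs v/w to be constant up to a factor 1 + O(ε), which
the contraction supplies (`ratioBound_scaling_mixture`).

First variations are unique up to constants, so the Wasserstein gradient is unique and the
statements about flows follow from the identities of vector fields. -/

set_option linter.unusedSectionVars false

namespace Sinkformer

/-! ### Integration of continuous functions against compactly supported measures -/

section CompactSupport

variable {X : Type*} [MetricSpace X] [ProperSpace X] [MeasurableSpace X] [BorelSpace X]
  {K : Set X} {μ ν : Measure X}

theorem integrable_of_continuous {E : Type*} [NormedAddCommGroup E] [SecondCountableTopology E]
    [IsFiniteMeasure μ] (hK : IsCompact K)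
    (hμ : ∀ᵐ x ∂μ, x ∈ K) {g : X → E} (hg : Continuous g) : Integrable g μ := by
  have h : IntegrableOn g K μ := hg.continuousOn.integrableOn_compact hK
  rwa [IntegrableOn, Measure.restrict_eq_self_of_ae_mem hμ] at h

theorem integrable_prod_of_continuous [IsFiniteMeasure μ] [IsFiniteMeasure ν] (hK : IsCompact K)
    (hμ : ∀ᵐ x ∂μ, x ∈ K) (hν : ∀ᵐ x ∂ν, x ∈ K) {g : X × X → ℝ} (hg : Continuous g) :
    Integrable g (μ.prod ν) := by
  have hmem : ∀ᵐ p ∂μ.prod ν, p ∈ K ×ˢ K := by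
    filter_upwards [Measure.quasiMeasurePreserving_fst.ae hμ,
      Measure.quasiMeasurePreserving_snd.ae hν] with p h₁ h₂ using ⟨h₁, h₂⟩
  exact integrable_of_continuous (hK.prod hK) hmem hg

theorem integral_pos_of_ae_pos [NeZero μ] {g : X → ℝ} (hg : ∀ᵐ x ∂μ, 0 < g x)
    (hint : Integrable g μ) : 0 < ∫ x, g x ∂μ := by
  have h0 : 0 ≤ᵐ[μ] g := hg.mono fun x hx => hx.le
  refine lt_of_le_of_ne (integral_nonneg_of_ae h0) fun h => ?_
  have h1 := (integral_eq_zero_iff_of_nonneg_ae h0 hint).1 h.symm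
  obtain ⟨x, hx, hx'⟩ := (hg.and h1).exists
  exact hx.ne' hx'

/-- A positive symmetric continuous kernel. -/
structure IsScalingKernel (k : X → X → ℝ) : Prop where
  continuous : Continuous fun p : X × X => k p.1 p.2
  pos : ∀ x y, 0 < k x y
  symm : ∀ x y, k x y = k y x

/-- The integral operator `w ↦ ∫ k(·, y) w(y) dμ(y)`. -/
noncomputable def integralOp (k : X → X → ℝ) (μ : Measure X) (w : X → ℝ) (x : X) : ℝ :=
  ∫ y, k x y * w y ∂μ

/-- The oscillation of `k(·, z)` on `K` is at most `C`, uniformly in `z ∈ K`. -/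
def HarnackOn (K : Set X) (C : ℝ) (k : X → X → ℝ) : Prop :=
  ∀ x ∈ K, ∀ y ∈ K, ∀ z ∈ K, k x z ≤ C * k y z

/-- The quotient `u / v` oscillates on `K` by a factor of at most `R`. -/
def RatioBound (K : Set X) (R : ℝ) (u v : X → ℝ) : Prop :=
  ∀ x ∈ K, ∀ y ∈ K, u x * v y ≤ R * (u y * v x)

/-- The positive continuous solutions of the scaling equation `w · ∫ k(·, y) w(y) dμ(y) = 1`. -/
structure IsScaling (k : X → X → ℝ) (μ : Measure X) (w : X → ℝ) : Prop where
  continuous : Continuous w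
  pos : ∀ x, 0 < w x
  mul_eq_one : ∀ x, w x * integralOp k μ w x = 1

variable {k : X → X → ℝ} {u v w : X → ℝ} {C R : ℝ}

/-! ### Regularity and positivity of the integral operator. -/

theorem IsScalingKernel.continuous_right (hk : IsScalingKernel k) (x : X) :
    Continuous (k x) :=
  hk.continuous.comp (by fun_prop : Continuous fun y => (x, y))

theorem IsScalingKernel.exists_harnackOn (hk : IsScalingKernel k) (hK : IsCompact K) :
    ∃ C, 1 ≤ C ∧ HarnackOn K C k := by
  rcases K.eq_empty_or_nonempty with rfl | hne
  · exact ⟨1, le_rfl, by simp [HarnackOn]⟩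
  obtain ⟨p, hp, hmin⟩ := (hK.prod hK).exists_isMinOn (hne.prod hne) hk.continuous.continuousOn
  obtain ⟨q, hq, hmax⟩ := (hK.prod hK).exists_isMaxOn (hne.prod hne) hk.continuous.continuousOn
  have hp0 := hk.pos p.1 p.2
  refine ⟨k q.1 q.2 / k p.1 p.2, (one_le_div hp0).2 (hmin hq), fun x hx y hy z hz => ?_⟩
  have h1 : k x z ≤ k q.1 q.2 := hmax (show (x, z) ∈ K ×ˢ K from ⟨hx, hz⟩)
  have h2 : k p.1 p.2 ≤ k y z := hmin (show (y, z) ∈ K ×ˢ K from ⟨hy, hz⟩)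
  calc k x z ≤ k q.1 q.2 := h1
    _ = k q.1 q.2 / k p.1 p.2 * k p.1 p.2 := by field_simp
    _ ≤ _ := mul_le_mul_of_nonneg_left h2 (div_pos (hk.pos _ _) hp0).le

/-- The weight need only be measurable and essentially bounded: the pointwise limit of normalised
Sinkhorn factors is not yet known to be continuous, and it is the operator that regularises it. -/
theorem continuous_integralOp [IsFiniteMeasure μ] (hk : IsScalingKernel k) (hK : IsCompact K)
    (hμ : ∀ᵐ x ∂μ, x ∈ K) (hw : AEStronglyMeasurable w μ) {B : ℝ} (hB : ∀ᵐ y ∂μ, |w y| ≤ B) :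
    Continuous (integralOp k μ w) := by
  refine continuous_iff_continuousAt.2 fun x₀ => ?_
  obtain ⟨M, hM⟩ := ((isCompact_closedBall x₀ 1).prod hK).exists_bound_of_continuousOn
    hk.continuous.continuousOn
  refine continuousAt_of_dominated (bound := fun _ => M * B) ?_ ?_ (integrable_const _) ?_
  · exact Eventually.of_forall fun x => (hk.continuous_right x).aestronglyMeasurable.mul hw
  · filter_upwards [Metric.closedBall_mem_nhds x₀ one_pos] with x hx
    filter_upwards [hμ, hB] with y hy hyB
    rw [norm_mul]
    have h := hM (x, y) ⟨hx, hy⟩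
    exact mul_le_mul h hyB (norm_nonneg _) ((norm_nonneg _).trans h)
  · refine Eventually.of_forall fun y => Continuous.continuousAt ?_
    exact (hk.continuous.comp (by fun_prop : Continuous fun x => (x, y))).mul continuous_const

theorem exists_ae_bound (hK : IsCompact K) (hμ : ∀ᵐ x ∂μ, x ∈ K) (hw : Continuous w) :
    ∃ B, ∀ᵐ y ∂μ, |w y| ≤ B := by
  obtain ⟨B, hB⟩ := hK.exists_bound_of_continuousOn hw.continuousOn
  exact ⟨B, hμ.mono fun y hy => hB y hy⟩

theorem continuous_integralOp_of_continuous [IsFiniteMeasure μ] (hk : IsScalingKernel k)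
    (hK : IsCompact K) (hμ : ∀ᵐ x ∂μ, x ∈ K) (hw : Continuous w) :
    Continuous (integralOp k μ w) := by
  obtain ⟨B, hB⟩ := exists_ae_bound hK hμ hw
  exact continuous_integralOp hk hK hμ hw.aestronglyMeasurable hB

theorem integrable_kernel_mul [IsFiniteMeasure μ] (hk : IsScalingKernel k)
    (hK : IsCompact K) (hμ : ∀ᵐ x ∂μ, x ∈ K) (hw : Continuous w) (x : X) :
    Integrable (fun y => k x y * w y) μ :=
  integrable_of_continuous hK hμ ((hk.continuous_right x).mul hw)

theorem integralOp_pos [IsProbabilityMeasure μ] (hk : IsScalingKernel k)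
    (hK : IsCompact K) (hμ : ∀ᵐ x ∂μ, x ∈ K) (hw : Continuous w) (hpos : ∀ x, 0 < w x) (x : X) :
    0 < integralOp k μ w x :=
  integral_pos_of_ae_pos (Eventually.of_forall fun y => mul_pos (hk.pos x y) (hpos y))
    (integrable_kernel_mul hk hK hμ hw x)

/-- The integral operator of a kernel with the Harnack property improves nonnegative functions. -/
theorem HarnackOn.integralOp_le [IsFiniteMeasure μ] (hH : HarnackOn K C k)
    (hk : IsScalingKernel k) (hK : IsCompact K) (hμ : ∀ᵐ x ∂μ, x ∈ K) (hw : Continuous w)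
    (hpos : ∀ x ∈ K, 0 ≤ w x) {x y : X} (hx : x ∈ K) (hy : y ∈ K) :
    integralOp k μ w x ≤ C * integralOp k μ w y := by
  rw [integralOp, integralOp, ← integral_const_mul]
  refine integral_mono_ae (integrable_kernel_mul hk hK hμ hw x)
    ((integrable_kernel_mul hk hK hμ hw y).const_mul C) ?_
  filter_upwards [hμ] with z hz
  have := mul_le_mul_of_nonneg_right (hH x hx y hy z hz) (hpos z hz)
  linarith

/-! ### Contraction of the projective oscillation -/

theorem RatioBound.inv (h : RatioBound K R u v) (hu : ∀ x, 0 < u x) (hv : ∀ x, 0 < v x) :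
    RatioBound K R (fun x => (u x)⁻¹) (fun x => (v x)⁻¹) := fun x hx y hy => by
  have h1 := h y hy x hx
  have := hu x
  have := hu y
  have := hv x
  have := hv y
  rw [← mul_inv, ← mul_inv, ← div_eq_mul_inv, le_div_iff₀ (by positivity),
    inv_mul_le_iff₀ (by positivity)]
  linarith

theorem RatioBound.trans {R' : ℝ} (h : RatioBound K R u v) (h' : RatioBound K R' v w)
    (hu : ∀ x, 0 < u x) (hv : ∀ x, 0 < v x) (hw : ∀ x, 0 < w x) (hR : 0 ≤ R) :
    RatioBound K (R * R') u w := fun x hx y hy => by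
  have := hu x
  have := hu y
  have := hv x
  have := hv y
  have := hw x
  have := hw y
  have h3 := mul_le_mul (h x hx y hy) (h' x hx y hy) (by positivity) (by positivity)
  refine le_of_mul_le_mul_right ?_ (mul_pos (hv x) (hv y))
  linarith

/-- Subtracting from u the largest multiple a·v below it on `K` leaves a nonnegative remainder,
whose image obeys the Harnack inequality. The images at x and y thus share a definite fraction of
the remainder, which gives the gain C⁻². -/
theorem RatioBound.integralOp_integralOp [IsProbabilityMeasure μ] (hk : IsScalingKernel k)
    (hK : IsCompact K) (hμ : ∀ᵐ x ∂μ, x ∈ K) (hC : 1 ≤ C) (hH : HarnackOn K C k)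
    (hu : Continuous u) (hv : Continuous v) (hu0 : ∀ x, 0 < u x) (hv0 : ∀ x, 0 < v x)
    (h : RatioBound K R u v) :
    RatioBound K (1 + (1 - (C ^ 2)⁻¹) * (R - 1)) (integralOp k μ u) (integralOp k μ v) := by
  intro x hx y hy
  obtain ⟨z, hz, hmin⟩ := hK.exists_isMinOn ⟨x, hx⟩
    (hu.div₀ hv fun x => (hv0 x).ne').continuousOn
  set a := u z / v z with ha
  have ha0 : 0 < a := div_pos (hu0 z) (hv0 z)
  have hlow : ∀ t ∈ K, 0 ≤ u t - a * v t := fun t ht => by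
    have h1 : a ≤ u t / v t := hmin ht
    rw [le_div_iff₀ (hv0 t)] at h1
    linarith
  have hupp : ∀ t ∈ K, u t ≤ R * a * v t := fun t ht => by
    have h1 := h t ht z hz
    have := hv0 z
    rw [ha]
    field_simp
    linarith
  have hIu := integrable_kernel_mul hk hK hμ hu
  have hIv := integrable_kernel_mul hk hK hμ hv
  have hdiff : ∀ t, integralOp k μ (fun s => u s - a * v s) t
      = integralOp k μ u t - a * integralOp k μ v t := fun t => by
    simp only [integralOp]
    rw [← integral_const_mul, ← integral_sub (hIu t) ((hIv t).const_mul a)]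
    exact integral_congr_ae (Eventually.of_forall fun s => by ring)
  have h1 := hH.integralOp_le hk hK hμ
    (show Continuous fun s => u s - a * v s by fun_prop) hlow hx hy
  have h2 := hH.integralOp_le hk hK hμ hv (fun t _ => (hv0 t).le) hy hx
  rw [hdiff, hdiff] at h1
  have hVx := integralOp_pos hk hK hμ hv hv0 x
  have hVy := integralOp_pos hk hK hμ hv hv0 y
  have h3 : integralOp k μ u x ≤ R * a * integralOp k μ v x := by
    simp only [integralOp]
    rw [← integral_const_mul]
    refine integral_mono_ae (hIu x) ((hIv x).const_mul _) ?_
    filter_upwards [hμ] with t ht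
    have := mul_le_mul_of_nonneg_left (hupp t ht) (hk.pos x t).le
    linarith
  have h4 : ∀ t, a * integralOp k μ v t ≤ integralOp k μ u t := fun t => by
    rw [← sub_nonneg, ← hdiff]
    refine integral_nonneg_of_ae ?_
    filter_upwards [hμ] with s hs using mul_nonneg (hk.pos t s).le (hlow s hs)
  have h4x := h4 x
  have h4y := h4 y
  generalize integralOp k μ u x = Ux at *
  generalize integralOp k μ v x = Vx at *
  generalize integralOp k μ u y = Uy at *
  generalize integralOp k μ v y = Vy at *
  have hC0 : 0 < C := by linarith
  have hd : 0 ≤ 1 - (C ^ 2)⁻¹ := sub_nonneg.2 (inv_le_one_of_one_le₀ (by nlinarith))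
  -- One factor C comes from the remainder u - a·v, the other from v with x and y exchanged.
  have h5 : (Ux - a * Vx) * Vy ≤ C ^ 2 * ((Uy - a * Vy) * Vx) := by
    calc (Ux - a * Vx) * Vy ≤ (C * (Uy - a * Vy)) * (C * Vx) :=
          mul_le_mul h1 h2 hVy.le (by nlinarith)
      _ = _ := by ring
  have h6 : (C ^ 2)⁻¹ * ((Ux - a * Vx) * Vy) ≤ (Uy - a * Vy) * Vx := by
    rwa [inv_mul_le_iff₀ (by positivity)]
  -- The difference Ux·Vy - Uy·Vx is unchanged when a·V is subtracted from U. By `h6` it is at most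
  -- 1 - C⁻² times (Ux - a·Vx)·Vy, which is bounded here.
  have h7 : (1 - (C ^ 2)⁻¹) * ((Ux - a * Vx) * Vy) ≤
      (1 - (C ^ 2)⁻¹) * ((R - 1) * (Uy * Vx)) := by
    refine mul_le_mul_of_nonneg_left ?_ hd
    have hR : 0 ≤ (R - 1) := by
      have := h z hz z hz
      have := mul_pos (hu0 z) (hv0 z)
      nlinarith
    calc (Ux - a * Vx) * Vy ≤ ((R - 1) * a * Vx) * Vy :=
          mul_le_mul_of_nonneg_right (by linarith) hVy.le
      _ = (R - 1) * Vx * (a * Vy) := by ring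
      _ ≤ (R - 1) * Vx * Uy := mul_le_mul_of_nonneg_left h4y (by positivity)
      _ = _ := by ring
  nlinarith

end CompactSupport

/-! ### Convergence of Sinkhorn's iterations -/

section Iteration

variable {X : Type*} [MetricSpace X] [ProperSpace X] [MeasurableSpace X] [BorelSpace X]
  {K : Set X} {μ ν : Measure X} {k : X → X → ℝ} {u v w : X → ℝ} {C R : ℝ}

/-- The scaling factors of Sinkhorn's iterations. -/
noncomputable def scalingIter (k : X → X → ℝ) (μ : Measure X) : ℕ → X → ℝ
  | 0 => fun _ => 1
  | n + 1 => fun x => (integralOp k μ (scalingIter k μ n) x)⁻¹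

theorem scalingIter_continuous_pos [IsProbabilityMeasure μ] (hk : IsScalingKernel k)
    (hK : IsCompact K) (hμ : ∀ᵐ x ∂μ, x ∈ K) (n : ℕ) :
    Continuous (scalingIter k μ n) ∧ ∀ x, 0 < scalingIter k μ n x := by
  induction n with
  | zero => exact ⟨continuous_const, fun _ => one_pos⟩
  | succ n ih =>
    have hpos := integralOp_pos hk hK hμ ih.1 ih.2
    exact ⟨(continuous_integralOp_of_continuous hk hK hμ ih.1).inv₀ fun x => (hpos x).ne',
      fun x => inv_pos.2 (hpos x)⟩

theorem integralOp_const_mul (a : ℝ) (x : X) :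
    integralOp k μ (fun y => a * w y) x = a * integralOp k μ w x := by
  simp only [integralOp]
  rw [← integral_const_mul]
  exact integral_congr_ae (Eventually.of_forall fun y => by ring)

/-- Each normalisation replaces the older of the two factors. As the kernel is symmetric, row and
column steps use the same operator, so a single sequence of factors suffices and the parity only
decides which variable carries the newer one. -/
theorem sinkhornIter_succ_eq [IsProbabilityMeasure μ] (hk : IsScalingKernel k)
    (hK : IsCompact K) (hμ : ∀ᵐ x ∂μ, x ∈ K) (n : ℕ) (x x' : X) :
    sinkhornIter k μ (n + 1) x x' = if Even n
      then k x x' * (scalingIter k μ (n + 1) x * scalingIter k μ n x')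
      else k x x' * (scalingIter k μ (n + 1) x' * scalingIter k μ n x) := by
  induction n generalizing x x' with
  | zero => simp [sinkhornIter, scalingIter, integralOp, div_eq_mul_inv]
  | succ n ih =>
    rw [sinkhornIter]
    obtain ⟨-, hpos⟩ := scalingIter_continuous_pos hk hK hμ n
    have hx := (hpos x).ne'
    have hx' := (hpos x').ne'
    by_cases hn : Even n
    · have hn' : ¬ Even (n + 1) := by simpa [Nat.even_add_one] using hn
      simp only [ih, hn, hn', if_true, if_false]
      have h : ∫ y, k y x' * (scalingIter k μ (n + 1) y * scalingIter k μ n x') ∂μ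
          = integralOp k μ (scalingIter k μ (n + 1)) x' * scalingIter k μ n x' := by
        rw [integralOp, ← integral_mul_const]
        exact integral_congr_ae (Eventually.of_forall fun y => by simp only [hk.symm y x']; ring)
      rw [h, show scalingIter k μ (n + 1 + 1) x'
        = (integralOp k μ (scalingIter k μ (n + 1)) x')⁻¹ from rfl]
      field_simp
    · have hn' : Even (n + 1) := by simpa [Nat.even_add_one] using hn
      simp only [ih, hn, hn', if_true, if_false]
      have h : ∫ y, k x y * (scalingIter k μ (n + 1) y * scalingIter k μ n x) ∂μ
          = integralOp k μ (scalingIter k μ (n + 1)) x * scalingIter k μ n x := by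
        rw [integralOp, ← integral_mul_const]
        exact integral_congr_ae (Eventually.of_forall fun y => by ring)
      rw [h, show scalingIter k μ (n + 1 + 1) x
        = (integralOp k μ (scalingIter k μ (n + 1)) x)⁻¹ from rfl]
      field_simp

theorem RatioBound.inv_integralOp [IsProbabilityMeasure μ] (hk : IsScalingKernel k)
    (hK : IsCompact K) (hμ : ∀ᵐ x ∂μ, x ∈ K) (hC : 1 ≤ C) (hH : HarnackOn K C k)
    (hu : Continuous u) (hv : Continuous v) (hu0 : ∀ x, 0 < u x) (hv0 : ∀ x, 0 < v x)
    (h : RatioBound K R u v) :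
    RatioBound K (1 + (1 - (C ^ 2)⁻¹) * (R - 1)) (fun x => (integralOp k μ u x)⁻¹)
      (fun x => (integralOp k μ v x)⁻¹) :=
  (h.integralOp_integralOp hk hK hμ hC hH hu hv hu0 hv0).inv
    (integralOp_pos hk hK hμ hu hu0) (integralOp_pos hk hK hμ hv hv0)

/-- The Harnack bound is applied to the product kernel built from u/v; taking the third point equal
to x cancels the common factor. -/
theorem exists_ratioBound (hK : IsCompact K) (hu : Continuous u) (hv : Continuous v)
    (hu0 : ∀ x, 0 < u x) (hv0 : ∀ x, 0 < v x) : ∃ R, 1 ≤ R ∧ RatioBound K R u v := by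
  have hk : IsScalingKernel fun x y : X => u x / v x * (u y / v y) :=
    ⟨((hu.comp continuous_fst).div₀ (hv.comp continuous_fst) fun p => (hv0 _).ne').mul
      ((hu.comp continuous_snd).div₀ (hv.comp continuous_snd) fun p => (hv0 _).ne'),
      fun x y => mul_pos (div_pos (hu0 x) (hv0 x)) (div_pos (hu0 y) (hv0 y)),
      fun x y => mul_comm _ _⟩
  obtain ⟨R, hR, h⟩ := hk.exists_harnackOn hK
  refine ⟨R, hR, fun x hx y hy => ?_⟩
  have h1 := h x hx y hy x hx
  have hux := hu0 x
  have hvx := hv0 x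
  have hvy := hv0 y
  rw [← mul_assoc] at h1
  have h2 := le_of_mul_le_mul_right h1 (div_pos hux hvx)
  rw [← mul_div_assoc, div_le_div_iff₀ hvx hvy] at h2
  linarith

/-- Two abstract orbits of u ↦ 1/L_μ u are compared, in order to cover both the factors against
their own shift (existence of the scaling) and the factors against a fixed scaling (convergence). -/
theorem ratioBound_scalingIter_of_iterate [IsProbabilityMeasure μ] (hk : IsScalingKernel k)
    (hK : IsCompact K) (hμ : ∀ᵐ x ∂μ, x ∈ K) (hC : 1 ≤ C) (hH : HarnackOn K C k)
    {a b : ℕ → X → ℝ} (ha : ∀ n, Continuous (a n)) (hb : ∀ n, Continuous (b n))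
    (ha0 : ∀ n x, 0 < a n x) (hb0 : ∀ n x, 0 < b n x)
    (ha' : ∀ n x, a (n + 1) x = (integralOp k μ (a n) x)⁻¹)
    (hb' : ∀ n x, b (n + 1) x = (integralOp k μ (b n) x)⁻¹)
    (h : RatioBound K R (a 0) (b 0)) (n : ℕ) :
    RatioBound K (1 + (R - 1) * (1 - (C ^ 2)⁻¹) ^ n) (a n) (b n) := by
  induction n with
  | zero => simpa using h
  | succ n ih =>
    have h1 := ih.inv_integralOp hk hK hμ hC hH (ha n) (hb n) (ha0 n) (hb0 n)
    rw [← funext (ha' n), ← funext (hb' n)] at h1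
    convert h1 using 1
    ring

theorem RatioBound.abs_log_le (h : RatioBound K R u v) (hu0 : ∀ x, 0 < u x)
    (hv0 : ∀ x, 0 < v x) {x y : X} (hx : x ∈ K) (hy : y ∈ K) :
    |Real.log (u x / v x) - Real.log (u y / v y)| ≤ R - 1 := by
  have key : ∀ x ∈ K, ∀ y ∈ K, Real.log (u x / v x) - Real.log (u y / v y) ≤ R - 1 := by
    intro x hx y hy
    have hux := hu0 x
    have hvx := hv0 x
    have huy := hu0 y
    have hvy := hv0 y
    rw [← Real.log_div (by positivity) (by positivity)]
    refine (Real.log_le_sub_one_of_pos (by positivity)).trans (sub_le_sub_right ?_ 1)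
    rw [div_div_div_eq, div_le_iff₀ (by positivity)]
    linarith [h x hx y hy]
  rw [abs_le]
  constructor
  · linarith [key y hy x hx]
  · exact key x hx y hy

/-- The factors may keep alternating in scale, so only their values relative to a base point z can
be expected to converge. The limit solves the scaling equation up to a multiplicative constant,
which a square root removes. -/
theorem exists_isScaling [IsProbabilityMeasure μ] (hk : IsScalingKernel k)
    (hK : IsCompact K) (hμ : ∀ᵐ x ∂μ, x ∈ K) : ∃ w, IsScaling k μ w := by
  obtain ⟨C, hC, hH⟩ := hk.exists_harnackOn hK
  have hC0 : 0 < C := by linarith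
  set q := 1 - (C ^ 2)⁻¹ with hq
  have hq0 : 0 ≤ q := sub_nonneg.2 (inv_le_one_of_one_le₀ (by nlinarith))
  have hq1 : q < 1 := sub_lt_self _ (by positivity)
  obtain ⟨z, hz⟩ : ∃ z, z ∈ K := hμ.exists
  set s := scalingIter k μ with hs
  have hsc : ∀ n, Continuous (s n) := fun n => (scalingIter_continuous_pos hk hK hμ n).1
  have hs0 : ∀ n x, 0 < s n x := fun n => (scalingIter_continuous_pos hk hK hμ n).2
  obtain ⟨R, hR, hRb⟩ := exists_ratioBound hK (hsc 1) (hsc 0) (hs0 1) (hs0 0)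
  have hratio := ratioBound_scalingIter_of_iterate hk hK hμ hC hH (a := fun n => s (n + 1))
    (b := s) (fun n => hsc _) hsc (fun n => hs0 _) hs0 (fun n x => rfl) (fun n x => rfl) hRb
  -- The iterates normalised at `z` converge on `K`.
  have hcauchy : ∀ x ∈ K, CauchySeq fun n => Real.log (s n x / s n z) := by
    intro x hx
    refine cauchySeq_of_le_geometric q (R - 1) hq1 fun n => ?_
    have h1 := (hratio n).abs_log_le (hs0 _) (hs0 _) hx hz
    rw [Real.dist_eq, abs_sub_comm]
    have h2 := (hs0 n x).ne'
    have h3 := (hs0 n z).ne'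
    have h4 := (hs0 (n + 1) x).ne'
    have h5 := (hs0 (n + 1) z).ne'
    simp only [Real.log_div, h2, h3, h4, h5, ne_eq, not_false_eq_true] at h1 ⊢
    convert h1 using 2 <;> ring
  -- This bound, uniform in n, is what dominates the passage to the limit under the integral.
  have hbd : ∀ n, ∀ x ∈ K, s n x / s n z ≤ C := by
    intro n x hx
    rw [div_le_iff₀ (hs0 n z)]
    cases n with
    | zero => simpa [hs, scalingIter] using hC
    | succ n =>
      have h1 := hH.integralOp_le hk hK hμ (hsc n) (fun t _ => (hs0 n t).le) hz hx
      have hx0 := integralOp_pos hk hK hμ (hsc n) (hs0 n) x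
      have hz0 := integralOp_pos hk hK hμ (hsc n) (hs0 n) z
      change (integralOp k μ (s n) x)⁻¹ ≤ C * (integralOp k μ (s n) z)⁻¹
      rw [← div_eq_mul_inv, le_div_iff₀ hz0, inv_mul_le_iff₀ hx0]
      linarith
  -- Off `K` the value is arbitrary, as μ does not see it.
  have hlim : ∀ x, ∃ l, x ∈ K → Tendsto (fun n => Real.log (s n x / s n z)) atTop (𝓝 l) := by
    intro x
    by_cases hx : x ∈ K
    · obtain ⟨l, hl⟩ := cauchySeq_tendsto_of_complete (hcauchy x hx)
      exact ⟨l, fun _ => hl⟩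
    · exact ⟨0, fun h => absurd h hx⟩
  choose f hf using hlim
  set v : X → ℝ := fun x => Real.exp (f x) with hv
  have hvlim : ∀ x ∈ K, Tendsto (fun n => s n x / s n z) atTop (𝓝 (v x)) := by
    intro x hx
    have h := (Real.continuous_exp.tendsto _).comp (hf x hx)
    refine h.congr fun n => ?_
    exact Real.exp_log (div_pos (hs0 n x) (hs0 n z))
  have hnc : ∀ n, Continuous fun x => s n x / s n z := fun n => (hsc n).div_const _
  have hvm : AEStronglyMeasurable v μ :=
    aestronglyMeasurable_of_tendsto_ae atTop (fun n => (hnc n).aestronglyMeasurable)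
      (hμ.mono hvlim)
  have hvb : ∀ᵐ y ∂μ, |v y| ≤ C := hμ.mono fun y hy => by
    rw [abs_of_pos (Real.exp_pos _)]
    exact le_of_tendsto (hvlim y hy) (Eventually.of_forall fun n => hbd n y hy)
  have hLv : Continuous (integralOp k μ v) := continuous_integralOp hk hK hμ hvm hvb
  have hLlim : ∀ x, Tendsto (fun n => integralOp k μ (fun y => s n y / s n z) x) atTop
      (𝓝 (integralOp k μ v x)) := by
    intro x
    refine tendsto_integral_of_dominated_convergence (fun y => k x y * C)
      (fun n => ((hk.continuous_right x).mul (hnc n)).aestronglyMeasurable)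
      (integrable_kernel_mul hk hK hμ continuous_const x) (fun n => ?_) ?_
    · filter_upwards [hμ] with y hy
      rw [Real.norm_of_nonneg (mul_pos (hk.pos x y) (div_pos (hs0 n y) (hs0 n z))).le]
      exact mul_le_mul_of_nonneg_left (hbd n y hy) (hk.pos x y).le
    · filter_upwards [hμ] with y hy using (hvlim y hy).const_mul _
  have hLpos : ∀ x, 0 < integralOp k μ v x := by
    intro x
    refine integral_pos_of_ae_pos
      (Eventually.of_forall fun y => mul_pos (hk.pos x y) (Real.exp_pos _)) ?_
    refine Integrable.mono' (integrable_kernel_mul hk hK hμ (continuous_const (y := C)) x)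
      ((hk.continuous_right x).aestronglyMeasurable.mul hvm) ?_
    filter_upwards [hvb] with y hy
    rw [norm_mul, Real.norm_of_nonneg (hk.pos x y).le]
    exact mul_le_mul_of_nonneg_left hy (hk.pos x y).le
  -- The limit is an eigenfunction of the scaling map on `K`.
  have heig : ∀ x ∈ K, integralOp k μ v z / integralOp k μ v x = v x := by
    intro x hx
    have h1 := ((hLlim z).div (hLlim x) (hLpos x).ne')
    refine tendsto_nhds_unique h1 (((hvlim x hx).comp (tendsto_add_atTop_nat 1)).congr fun n => ?_)
    have h2 : ∀ t, integralOp k μ (fun y => s n y / s n z) t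
        = (s n z)⁻¹ * integralOp k μ (s n) t := fun t => by
      rw [← integralOp_const_mul]
      simp only [div_eq_inv_mul]
    have h3 := (integralOp_pos hk hK hμ (hsc n) (hs0 n) x).ne'
    have h4 := (integralOp_pos hk hK hμ (hsc n) (hs0 n) z).ne'
    have h5 := (hs0 n z).ne'
    simp only [h2, Function.comp, Pi.div_apply]
    rw [show s (n + 1) x = (integralOp k μ (s n) x)⁻¹ from rfl,
      show s (n + 1) z = (integralOp k μ (s n) z)⁻¹ from rfl]
    field_simp
  -- On `K` one has v = c²/L_μ v, so c/L_μ v equals c⁻¹v there. Unlike v, the former is continuous,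
  -- and it solves the equation off `K` too because the integral only involves values on `K`.
  set c := √(integralOp k μ v z) with hc
  have hc0 : 0 < c := Real.sqrt_pos.2 (hLpos z)
  have hcc : c * c = integralOp k μ v z := Real.mul_self_sqrt (hLpos z).le
  refine ⟨fun x => c / integralOp k μ v x, continuous_const.div₀ hLv fun x => (hLpos x).ne',
    fun x => div_pos hc0 (hLpos x), fun x => ?_⟩
  have h1 : integralOp k μ (fun x => c / integralOp k μ v x) x
      = integralOp k μ (fun x => c⁻¹ * v x) x := by
    refine integral_congr_ae ?_
    filter_upwards [hμ] with y hy
    have := (hLpos y).ne'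
    rw [← heig y hy, ← hcc]
    field_simp
  rw [h1, integralOp_const_mul]
  have := (hLpos x).ne'
  field_simp

theorem tendsto_sinkhornIter [IsProbabilityMeasure μ] (hk : IsScalingKernel k)
    (hK : IsCompact K) (hμ : ∀ᵐ x ∂μ, x ∈ K) (hw : IsScaling k μ w) (x x' : X) :
    Tendsto (fun l => sinkhornIter k μ l x x') atTop (𝓝 (k x x' * (w x * w x'))) := by
  obtain ⟨C, hC, hH⟩ := hk.exists_harnackOn hK
  have hC0 : 0 < C := by linarith
  set q := 1 - (C ^ 2)⁻¹ with hq
  have hq0 : 0 ≤ q := sub_nonneg.2 (inv_le_one_of_one_le₀ (by nlinarith))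
  have hq1 : q < 1 := sub_lt_self _ (by positivity)
  obtain ⟨z, hz⟩ : ∃ z, z ∈ K := hμ.exists
  set s := scalingIter k μ with hs
  have hsc : ∀ n, Continuous (s n) := fun n => (scalingIter_continuous_pos hk hK hμ n).1
  have hs0 : ∀ n x, 0 < s n x := fun n => (scalingIter_continuous_pos hk hK hμ n).2
  have hw0 := hw.pos
  obtain ⟨R, hR, hRb⟩ := exists_ratioBound hK (hsc 0) hw.continuous (hs0 0) hw.pos
  have hratio := ratioBound_scalingIter_of_iterate hk hK hμ hC hH (a := s)
    (b := fun _ => w) hsc (fun _ => hw.continuous) hs0 (fun _ => hw.pos) (fun n x => rfl)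
    (fun n x => eq_inv_of_mul_eq_one_left (hw.mul_eq_one x)) hRb
  set Q : ℕ → ℝ := fun n => 1 + (R - 1) * q ^ n with hQ
  have hQ1 : ∀ n, 0 < Q n := fun n =>
    add_pos_of_pos_of_nonneg one_pos (mul_nonneg (by linarith) (pow_nonneg hq0 n))
  have hQlim : Tendsto Q atTop (𝓝 1) := by
    simpa using ((tendsto_pow_atTop_nhds_zero_of_lt_one hq0 hq1).const_mul (R - 1)).const_add 1
  set r : ℕ → X → ℝ := fun n y => s n y / w y with hr
  have hr0 : ∀ n y, 0 < r n y := fun n y => div_pos (hs0 n y) (hw0 y)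
  -- The quotients `r (n + 1) x` and `r n z` are asymptotically inverse to each other.
  have hprod : ∀ y, Tendsto (fun n => r (n + 1) y * r n z) atTop (𝓝 1) := by
    intro y
    have hLw : integralOp k μ w y = (w y)⁻¹ := eq_inv_of_mul_eq_one_right (hw.mul_eq_one y)
    have hIs := fun n => integrable_kernel_mul hk hK hμ (hsc n) y
    have hIw := integrable_kernel_mul hk hK hμ hw.continuous y
    have hwy := hw0 y
    have hwz := hw0 z
    -- On `K` the factor s n lies between r n z · w / Q n and Q n · r n z · w. Integrating against
    -- the kernel transfers this to every y, inside `K` or not.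
    have hup : ∀ n, integralOp k μ (s n) y ≤ Q n * r n z * (w y)⁻¹ := by
      intro n
      rw [← hLw, integralOp, integralOp, ← integral_const_mul]
      refine integral_mono_ae (hIs n) (hIw.const_mul _) ?_
      filter_upwards [hμ] with t ht
      have h1 := hratio n t ht z hz
      have h2 : s n t ≤ Q n * r n z * w t := by
        simp only [hr]
        rw [← mul_div_assoc, div_mul_eq_mul_div, le_div_iff₀ hwz]
        linarith
      have h3 := mul_le_mul_of_nonneg_left h2 (hk.pos y t).le
      linarith
    have hlo : ∀ n, r n z * (w y)⁻¹ ≤ Q n * integralOp k μ (s n) y := by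
      intro n
      rw [← hLw, integralOp, integralOp, ← integral_const_mul, ← integral_const_mul]
      refine integral_mono_ae (hIw.const_mul _) ((hIs n).const_mul _) ?_
      filter_upwards [hμ] with t ht
      have h1 := hratio n z hz t ht
      have h2 : r n z * w t ≤ Q n * s n t := by
        simp only [hr]
        rw [div_mul_eq_mul_div, div_le_iff₀ hwz]
        linarith
      have h3 := mul_le_mul_of_nonneg_left h2 (hk.pos y t).le
      linarith
    have heq : ∀ n, r (n + 1) y * r n z = r n z * (w y)⁻¹ / integralOp k μ (s n) y := by
      intro n
      simp only [hr]
      rw [show s (n + 1) y = (integralOp k μ (s n) y)⁻¹ from rfl]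
      have := (integralOp_pos hk hK hμ (hsc n) (hs0 n) y).ne'
      field_simp
    refine tendsto_of_tendsto_of_tendsto_of_le_of_le (g := fun n => (Q n)⁻¹) (h := Q)
      (by simpa using hQlim.inv₀ one_ne_zero) hQlim (fun n => ?_) (fun n => ?_)
    · have hpos := integralOp_pos hk hK hμ (hsc n) (hs0 n) y
      simp only [heq]
      rw [le_div_iff₀ hpos, inv_mul_le_iff₀ (hQ1 n)]
      linarith [hup n]
    · have hpos := integralOp_pos hk hK hμ (hsc n) (hs0 n) y
      simp only [heq]
      rw [div_le_iff₀ hpos]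
      exact hlo n
  have hpair : ∀ y y', Tendsto (fun n => s (n + 2) y * s (n + 1) y') atTop
      (𝓝 (w y * w y')) := by
    intro y y'
    -- Uses r(n+2, y) r(n+1, y') = [r(n+2, y) r(n+1, z)] [r(n+1, y') r(n, z)] / [r(n+1, z) r(n, z)]:
    -- the factors at z, which need not converge, cancel.
    have h1 := (((hprod y).comp (tendsto_add_atTop_nat 1)).mul (hprod y')).div
      (hprod z) one_ne_zero
    have h2 := h1.const_mul (w y * w y')
    simp only [mul_one, div_one] at h2
    refine h2.congr fun n => ?_
    have := (hw0 y).ne'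
    have := (hw0 y').ne'
    have := (hw0 z).ne'
    have := (hs0 n z).ne'
    have := (hs0 (n + 1) z).ne'
    simp only [hr, Function.comp, Pi.div_apply]
    field_simp
  rw [← tendsto_add_atTop_iff_nat 2]
  have h1 := (hpair x x').const_mul (k x x')
  have h2 := (hpair x' x).const_mul (k x x')
  rw [mul_comm (w x') (w x)] at h2
  rw [tendsto_iff_dist_tendsto_zero] at h1 h2 ⊢
  -- The sum of the distances for both orders of the variables bounds the distance for either
  -- parity.
  refine squeeze_zero (fun n => dist_nonneg) (fun n => ?_) (by simpa using h1.add h2)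
  rw [sinkhornIter_succ_eq hk hK hμ (n + 1)]
  split_ifs
  · exact le_add_of_nonneg_right dist_nonneg
  · exact le_add_of_nonneg_left dist_nonneg

theorem sinkhornKernel_eq [IsProbabilityMeasure μ] (hk : IsScalingKernel k)
    (hK : IsCompact K) (hμ : ∀ᵐ x ∂μ, x ∈ K) (hw : IsScaling k μ w) (x x' : X) :
    sinkhornKernel k μ x x' = k x x' * (w x * w x') :=
  (tendsto_sinkhornIter hk hK hμ hw x x').limUnder_eq

end Iteration

/-! ### Mixtures of measures -/

section Mixture

variable {X : Type*} [MeasurableSpace X] {μ ν : Measure X} {ε : ℝ}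

/-- The mixture `(1 - ε) μ + ε ν`. -/
noncomputable def mixture (μ ν : Measure X) (ε : ℝ) : Measure X :=
  ENNReal.ofReal (1 - ε) • μ + ENNReal.ofReal ε • ν

theorem mixture_zero : mixture μ ν 0 = μ := by simp [mixture]

theorem isProbabilityMeasure_mixture [IsProbabilityMeasure μ] [IsProbabilityMeasure ν]
    (h0 : 0 ≤ ε) (h1 : ε ≤ 1) : IsProbabilityMeasure (mixture μ ν ε) := by
  refine ⟨?_⟩
  simp only [mixture, Measure.add_apply, Measure.smul_apply, measure_univ, smul_eq_mul, mul_one]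
  rw [← ENNReal.ofReal_add (by linarith) h0]
  simp

theorem ae_mixture {p : X → Prop} (hμ : ∀ᵐ x ∂μ, p x) (hν : ∀ᵐ x ∂ν, p x) :
    ∀ᵐ x ∂mixture μ ν ε, p x :=
  ae_add_measure_iff.2 ⟨Measure.ae_smul_measure hμ _, Measure.ae_smul_measure hν _⟩

theorem integral_mixture {g : X → ℝ} (h0 : 0 ≤ ε) (h1 : ε ≤ 1) (hμ : Integrable g μ)
    (hν : Integrable g ν) :
    ∫ x, g x ∂mixture μ ν ε = (1 - ε) * ∫ x, g x ∂μ + ε * ∫ x, g x ∂ν := by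
  rw [mixture, integral_add_measure (hμ.smul_measure ENNReal.ofReal_ne_top)
    (hν.smul_measure ENNReal.ofReal_ne_top), integral_smul_measure, integral_smul_measure,
    ENNReal.toReal_ofReal (by linarith), ENNReal.toReal_ofReal h0, smul_eq_mul, smul_eq_mul]

end Mixture

theorem hasDerivWithinAt_Ici_of_quadratic_bound {f : ℝ → ℝ} {D M r : ℝ} (hr : 0 < r)
    (h : ∀ ε, 0 ≤ ε → ε ≤ r → |f ε - f 0 - ε * D| ≤ M * ε ^ 2) :
    HasDerivWithinAt f D (Ici 0) 0 := by
  rw [hasDerivWithinAt_iff_isLittleO]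
  have h1 : (fun x : ℝ => x ^ 2) =o[𝓝[Ici 0] 0] fun x : ℝ => x - 0 := by
    simpa [Function.id_def] using
      ((Asymptotics.isLittleO_pow_id (𝕜 := ℝ) one_lt_two).mono nhdsWithin_le_nhds)
  refine Asymptotics.IsBigO.trans_isLittleO (Asymptotics.IsBigO.of_bound M ?_) h1
  filter_upwards [self_mem_nhdsWithin, mem_nhdsWithin_of_mem_nhds (Iic_mem_nhds hr)] with ε h0 hεr
  have := h ε h0 hεr
  rw [Real.norm_eq_abs, Real.norm_of_nonneg (sq_nonneg ε)]
  simpa [smul_eq_mul] using this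

/-! ### The optimal scaling and its variation -/

section Variation

variable {X : Type*} [MetricSpace X] [ProperSpace X] [MeasurableSpace X] [BorelSpace X]
  {K : Set X} {μ ν : Measure X} {k : X → X → ℝ} {u v w : X → ℝ} {C R ε : ℝ}

theorem integral_mul_integralOp_comm [IsFiniteMeasure μ] [IsFiniteMeasure ν]
    (hk : IsScalingKernel k) (hK : IsCompact K) (hμ : ∀ᵐ x ∂μ, x ∈ K) (hν : ∀ᵐ x ∂ν, x ∈ K)
    (hu : Continuous u) (hv : Continuous v) :
    ∫ x, u x * integralOp k ν v x ∂μ = ∫ y, v y * integralOp k μ u y ∂ν := by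
  simp only [integralOp, ← integral_const_mul]
  rw [integral_integral_swap]
  · refine integral_congr_ae (Eventually.of_forall fun y =>
      integral_congr_ae (Eventually.of_forall fun x => ?_))
    simp only [hk.symm x y]
    ring
  · refine integrable_prod_of_continuous hK hμ hν ?_
    have := hk.continuous
    simp only [Function.uncurry_def]
    fun_prop

theorem IsScaling.continuous_log (hw : IsScaling k μ w) : Continuous fun x => Real.log (w x) :=
  hw.continuous.log fun x => (hw.pos x).ne'

/-- The scaling function maximises the dual entropic functional. -/
theorem IsScaling.integral_log_ge [IsProbabilityMeasure μ] (hk : IsScalingKernel k)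
    (hK : IsCompact K) (hμ : ∀ᵐ x ∂μ, x ∈ K) (hw : IsScaling k μ w) (hu : Continuous u)
    (hu0 : ∀ x, 0 < u x) :
    2 * ∫ x, Real.log (u x) ∂μ - ∫ x, u x * integralOp k μ u x ∂μ + 1
      ≤ 2 * ∫ x, Real.log (w x) ∂μ := by
  have hw0 := hw.pos
  have hwc := hw.continuous
  have hLu : Continuous fun x => Real.log (u x) := hu.log fun x => (hu0 x).ne'
  have hLw := hw.continuous_log
  set g : X → ℝ := fun x => Real.log (u x) - Real.log (w x) with hg
  have hgc : Continuous g := hLu.sub hLw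
  have hug : ∀ x, u x = w x * Real.exp (g x) := fun x => by
    rw [hg, Real.exp_sub, Real.exp_log (hu0 x), Real.exp_log (hw0 x)]
    have := (hw0 x).ne'
    field_simp
  -- This is exp t ≥ 1 + t at t = g x + g y, integrated in y against the weight k(x, y) w(x) w(y),
  -- whose marginal is μ.
  have hpt : ∀ x, 1 + g x + w x * integralOp k μ (fun y => w y * g y) x
      ≤ u x * integralOp k μ u x := by
    intro x
    have h1 : ∫ y, (1 + g x) * (w x * (k x y * w y)) ∂μ = 1 + g x := by
      have h := hw.mul_eq_one x
      rw [integralOp] at h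
      rw [integral_const_mul, integral_const_mul, h, mul_one]
    have hc1 : Continuous fun y => (1 + g x) * (w x * (k x y * w y)) := by
      have := hk.continuous_right x
      fun_prop
    have hc2 : Continuous fun y => w x * (k x y * (w y * g y)) := by
      have := hk.continuous_right x
      fun_prop
    have hc3 : Continuous fun y => u x * (k x y * u y) := by
      have := hk.continuous_right x
      fun_prop
    have h2 := integral_mono (integrable_of_continuous hK hμ (hc1.add hc2))
      (integrable_of_continuous hK hμ hc3) (fun y => by
        have h3 := mul_le_mul_of_nonneg_left (Real.add_one_le_exp (g x + g y))
          (mul_pos (hk.pos x y) (mul_pos (hw0 x) (hw0 y))).le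
        simp only [hug x, hug y]
        rw [Real.exp_add] at h3
        linarith : ∀ y, (1 + g x) * (w x * (k x y * w y)) + w x * (k x y * (w y * g y))
          ≤ u x * (k x y * u y))
    rw [integral_add' (integrable_of_continuous hK hμ hc1) (integrable_of_continuous hK hμ hc2),
      h1, integral_const_mul, integral_const_mul] at h2
    exact h2
  have hwg : Continuous fun y => w y * g y := hwc.mul hgc
  have hI1 : Integrable (fun x => 1 + g x) μ :=
    integrable_of_continuous hK hμ (continuous_const.add hgc)
  have hI2 : Integrable (fun x => w x * integralOp k μ (fun y => w y * g y) x) μ :=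
    integrable_of_continuous hK hμ
      (hwc.mul (continuous_integralOp_of_continuous hk hK hμ hwg))
  have h1 := integral_mono (hI1.add hI2) (integrable_of_continuous hK hμ
    (hu.mul (continuous_integralOp_of_continuous hk hK hμ hu))) hpt
  have h2 : ∫ x, w x * integralOp k μ (fun y => w y * g y) x ∂μ = ∫ x, g x ∂μ := by
    rw [integral_mul_integralOp_comm hk hK hμ hμ hwc hwg]
    refine integral_congr_ae (Eventually.of_forall fun x => ?_)
    linear_combination g x * hw.mul_eq_one x
  have h3 : ∫ x, g x ∂μ = ∫ x, Real.log (u x) ∂μ - ∫ x, Real.log (w x) ∂μ :=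
    integral_sub (integrable_of_continuous hK hμ hLu) (integrable_of_continuous hK hμ hLw)
  have h4 : ∫ x, (1 + g x) ∂μ = 1 + ∫ x, g x ∂μ := by
    rw [integral_add (integrable_const _) (integrable_of_continuous hK hμ hgc)]
    simp
  have h5 : ∫ x, (1 + g x + w x * integralOp k μ (fun y => w y * g y) x) ∂μ
      = 1 + ∫ x, g x ∂μ + ∫ x, g x ∂μ := by
    rw [integral_add hI1 hI2, h2, h4]
  have h6 : 1 + ∫ x, g x ∂μ + ∫ x, g x ∂μ ≤ ∫ x, u x * integralOp k μ u x ∂μ := h5 ▸ h1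
  linarith

/-- The logarithm splits as log w(x) + log w(x'), and both marginals of the scaled kernel equal μ.
-/
theorem integral_scaling_entropy [IsProbabilityMeasure μ] (hk : IsScalingKernel k)
    (hK : IsCompact K) (hμ : ∀ᵐ x ∂μ, x ∈ K) (hw : IsScaling k μ w) :
    Integrable (fun p : X × X => k p.1 p.2 * (w p.1 * w p.2) *
        Real.log (k p.1 p.2 * (w p.1 * w p.2) / k p.1 p.2)) (μ.prod μ) ∧
      ∫ p, k p.1 p.2 * (w p.1 * w p.2) *
        Real.log (k p.1 p.2 * (w p.1 * w p.2) / k p.1 p.2) ∂μ.prod μ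
        = 2 * ∫ x, Real.log (w x) ∂μ := by
  have hw0 := hw.pos
  have hwc := hw.continuous
  have hkc := hk.continuous
  have hLw := hw.continuous_log
  have heq : (fun p : X × X => k p.1 p.2 * (w p.1 * w p.2) *
      Real.log (k p.1 p.2 * (w p.1 * w p.2) / k p.1 p.2)) = fun p : X × X =>
      w p.1 * Real.log (w p.1) * (k p.1 p.2 * w p.2) +
        w p.1 * (k p.1 p.2 * (w p.2 * Real.log (w p.2))) := by
    funext p
    rw [mul_div_cancel_left₀ _ (hk.pos _ _).ne', Real.log_mul (hw0 _).ne' (hw0 _).ne']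
    ring
  have hc1 : Continuous fun p : X × X => w p.1 * Real.log (w p.1) * (k p.1 p.2 * w p.2) := by
    have := hLw.comp (continuous_fst (X := X) (Y := X))
    simp only [Function.comp_def] at this
    fun_prop
  have hc2 : Continuous fun p : X × X => w p.1 * (k p.1 p.2 * (w p.2 * Real.log (w p.2))) := by
    have := hLw.comp (continuous_snd (X := X) (Y := X))
    simp only [Function.comp_def] at this
    fun_prop
  have hI1 := integrable_prod_of_continuous hK hμ hμ hc1
  have hI2 := integrable_prod_of_continuous hK hμ hμ hc2
  rw [heq]
  refine ⟨hI1.add hI2, ?_⟩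
  rw [integral_add hI1 hI2, integral_prod _ hI1, integral_prod _ hI2]
  simp only [integral_const_mul]
  have h1 : ∫ x, w x * Real.log (w x) * ∫ y, k x y * w y ∂μ ∂μ = ∫ x, Real.log (w x) ∂μ := by
    refine integral_congr_ae (Eventually.of_forall fun x => ?_)
    have h := hw.mul_eq_one x
    rw [integralOp] at h
    linear_combination Real.log (w x) * h
  have h2 : ∫ x, w x * ∫ y, k x y * (w y * Real.log (w y)) ∂μ ∂μ = ∫ x, Real.log (w x) ∂μ := by
    have h := integral_mul_integralOp_comm hk hK hμ hμ hwc (hwc.mul hLw)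
    refine h.trans (integral_congr_ae (Eventually.of_forall fun x => ?_))
    simp only [Pi.mul_apply]
    linear_combination Real.log (w x) * hw.mul_eq_one x
  rw [h1, h2]
  ring

/-- As w = 1/L_μ w, it inherits the Harnack constant of the kernel, independently of the measure. -/
theorem IsScaling.le_mul [IsProbabilityMeasure μ] (hk : IsScalingKernel k)
    (hK : IsCompact K) (hμ : ∀ᵐ x ∂μ, x ∈ K) (hH : HarnackOn K C k) (hw : IsScaling k μ w)
    {x y : X} (hx : x ∈ K) (hy : y ∈ K) : w x ≤ C * w y := by
  have h := hH.integralOp_le hk hK hμ hw.continuous (fun t _ => (hw.pos t).le) hy hx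
  have hx1 := hw.mul_eq_one x
  have hy1 := hw.mul_eq_one y
  have h2 := mul_le_mul_of_nonneg_left h (mul_pos (hw.pos x) (hw.pos y)).le
  calc w x = w x * w y * integralOp k μ w y := by linear_combination (-w x) * hy1
    _ ≤ _ := h2
    _ = C * w y := by linear_combination (C * w y) * hx1

/-- Comparison of the integral operators of two probability measures on `K`. -/
theorem HarnackOn.integralOp_le_of_measure [IsProbabilityMeasure μ] [IsProbabilityMeasure ν]
    (hC : 1 ≤ C) (hH : HarnackOn K C k) (hk : IsScalingKernel k) (hK : IsCompact K)
    (hμ : ∀ᵐ x ∂μ, x ∈ K) (hν : ∀ᵐ x ∂ν, x ∈ K) (hw : Continuous w) (hw0 : ∀ x, 0 < w x)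
    (hwC : ∀ x ∈ K, ∀ y ∈ K, w x ≤ C * w y) {x : X} (hx : x ∈ K) :
    integralOp k ν w x ≤ C ^ 2 * integralOp k μ w x := by
  have h1 : ∀ y ∈ K, k x y * w y ≤ C ^ 2 * integralOp k μ w x := by
    intro y hy
    have h2 : ∫ _, k x y * w y ∂μ ≤ ∫ t, C ^ 2 * (k x t * w t) ∂μ := by
      refine integral_mono_ae (integrable_const _)
        ((integrable_kernel_mul hk hK hμ hw x).const_mul _) ?_
      filter_upwards [hμ] with t ht
      have h3 := hH y hy t ht x hx
      rw [hk.symm y x, hk.symm t x] at h3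
      have h4 := mul_le_mul h3 (hwC y hy t ht) (hw0 y).le
        (mul_nonneg (by linarith) (hk.pos x t).le)
      linarith
    rw [integral_const, probReal_univ, one_smul, integral_const_mul] at h2
    exact h2
  have h2 : ∫ y, k x y * w y ∂ν ≤ ∫ _, C ^ 2 * integralOp k μ w x ∂ν := by
    refine integral_mono_ae (integrable_kernel_mul hk hK hν hw x) (integrable_const _) ?_
    filter_upwards [hν] with y hy using h1 y hy
  simpa [integralOp] using h2

/-- Controls the ε² coefficient of the quadratic term along a mixture, uniformly in the measure
whose scaling is used. -/
theorem IsScaling.integral_mul_integralOp_le [IsProbabilityMeasure μ] [IsProbabilityMeasure ν]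
    (hC : 1 ≤ C) (hH : HarnackOn K C k) (hk : IsScalingKernel k) (hK : IsCompact K)
    (hμ : ∀ᵐ x ∂μ, x ∈ K) (hν : ∀ᵐ x ∂ν, x ∈ K) (hw : IsScaling k μ w) :
    ∫ x, w x * integralOp k ν w x ∂ν ≤ C ^ 2 := by
  have h : ∫ x, w x * integralOp k ν w x ∂ν ≤ ∫ _, C ^ 2 ∂ν := by
    refine integral_mono_ae (integrable_of_continuous hK hν (hw.continuous.mul
      (continuous_integralOp_of_continuous hk hK hν hw.continuous))) (integrable_const _) ?_
    filter_upwards [hν] with x hx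
    have h1 := hH.integralOp_le_of_measure hC hk hK hμ hν hw.continuous hw.pos
      (fun x hx y hy => hw.le_mul hk hK hμ hH hx hy) hx
    have h2 := mul_le_mul_of_nonneg_left h1 (hw.pos x).le
    refine h2.trans_eq ?_
    linear_combination C ^ 2 * hw.mul_eq_one x
  simpa using h

/-! ### Perturbation of the scaling along a mixture. -/

theorem integralOp_mixture [IsFiniteMeasure μ] [IsFiniteMeasure ν] (hk : IsScalingKernel k)
    (hK : IsCompact K) (hμ : ∀ᵐ x ∂μ, x ∈ K) (hν : ∀ᵐ x ∂ν, x ∈ K) (hw : Continuous w)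
    (h0 : 0 ≤ ε) (h1 : ε ≤ 1) (x : X) :
    integralOp k (mixture μ ν ε) w x
      = (1 - ε) * integralOp k μ w x + ε * integralOp k ν w x :=
  integral_mixture h0 h1 (integrable_kernel_mul hk hK hμ hw x)
    (integrable_kernel_mul hk hK hν hw x)

/-- The scaling functions of `μ` and of `(1 - ε) μ + ε ν` differ by `O(ε)` up to a constant
factor. -/
theorem ratioBound_scaling_mixture [IsProbabilityMeasure μ] [IsProbabilityMeasure ν]
    (hC : 1 ≤ C) (hH : HarnackOn K C k) (hk : IsScalingKernel k) (hK : IsCompact K)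
    (hμ : ∀ᵐ x ∂μ, x ∈ K) (hν : ∀ᵐ x ∂ν, x ∈ K) (h0 : 0 ≤ ε) (h1 : ε ≤ 1 / 2)
    (hv : IsScaling k (mixture μ ν ε) v) (hw : IsScaling k μ w) :
    RatioBound K (1 + 2 * C ^ 6 * ε) v w := by
  have hmix : ∀ᵐ x ∂mixture μ ν ε, x ∈ K := ae_mixture hμ hν
  have : IsProbabilityMeasure (mixture μ ν ε) :=
    isProbabilityMeasure_mixture h0 (h1.trans (by norm_num))
  have hvc := hv.continuous
  have hwc := hw.continuous
  have hv0 := hv.pos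
  have hw0 := hw.pos
  have hne : K.Nonempty := hμ.exists
  have hvC : ∀ x ∈ K, ∀ y ∈ K, v x ≤ C * v y := fun x hx y hy => hv.le_mul hk hK hmix hH hx hy
  have hwC : ∀ x ∈ K, ∀ y ∈ K, w x ≤ C * w y := fun x hx y hy => hw.le_mul hk hK hμ hH hx hy
  set e := 1 + 2 * C ^ 2 * ε with he
  have hC2 : 1 ≤ C ^ 2 := one_le_pow₀ hC
  have he1 : 1 ≤ e := le_add_of_nonneg_right (by positivity)
  have hcmp : RatioBound K e (integralOp k (mixture μ ν ε) v) (integralOp k μ v) := by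
    intro x hx y hy
    have hx0 := integralOp_pos hk hK hμ hvc hv0 x
    have hy0 := integralOp_pos hk hK hμ hvc hv0 y
    have hy1 := integralOp_pos hk hK hν hvc hv0 y
    rw [integralOp_mixture hk hK hμ hν hvc h0 (by linarith),
      integralOp_mixture hk hK hμ hν hvc h0 (by linarith)]
    have h2 := hH.integralOp_le_of_measure hC hk hK hμ hν hvc hv0 hvC hx
    -- The factor 2 in `e` and the restriction ε ≤ 1/2 meet here: 2(1 - ε) ≥ 1.
    have h3 : (1 - ε) + ε * C ^ 2 ≤ e * (1 - ε) := by nlinarith [mul_nonneg h0 (sq_nonneg C)]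
    calc ((1 - ε) * integralOp k μ v x + ε * integralOp k ν v x) * integralOp k μ v y
        ≤ ((1 - ε) * integralOp k μ v x + ε * (C ^ 2 * integralOp k μ v x))
            * integralOp k μ v y := by gcongr
      _ = ((1 - ε) + ε * C ^ 2) * (integralOp k μ v y * integralOp k μ v x) := by ring
      _ ≤ e * (1 - ε) * (integralOp k μ v y * integralOp k μ v x) := by gcongr
      _ = e * (((1 - ε) * integralOp k μ v y) * integralOp k μ v x) := by ring
      _ ≤ _ := by
        have : 0 ≤ ε * integralOp k ν v y := mul_nonneg h0 hy1.le
        gcongr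
        linarith
  -- the best constant
  obtain ⟨p, hp, hmax⟩ := (hK.prod hK).exists_isMaxOn (hne.prod hne)
    (f := fun p : X × X => v p.1 * w p.2 / (v p.2 * w p.1))
    (Continuous.continuousOn (Continuous.div₀ (by fun_prop) (by fun_prop)
      fun p => (mul_pos (hv0 _) (hw0 _)).ne'))
  set R := v p.1 * w p.2 / (v p.2 * w p.1) with hR
  have hRb : RatioBound K R v w := fun x hx y hy => by
    have h2 : v x * w y / (v y * w x) ≤ R := hmax (show (x, y) ∈ K ×ˢ K from ⟨hx, hy⟩)
    rwa [div_le_iff₀ (mul_pos (hv0 y) (hw0 x))] at h2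
  have hbest : ∀ R', RatioBound K R' v w → R ≤ R' := fun R' h' => by
    rw [hR, div_le_iff₀ (mul_pos (hv0 _) (hw0 _))]
    exact h' _ hp.1 _ hp.2
  have hRC : R ≤ C ^ 2 := hbest _ fun x hx y hy => by
    have := mul_le_mul (hvC x hx y hy) (hwC y hy x hx) (hw0 y).le
      (mul_nonneg (by linarith) (hv0 y).le)
    linarith
  have hR1 : 1 ≤ R := by
    obtain ⟨x, hx⟩ := hne
    have h2 := hRb x hx x hx
    have h3 := mul_pos (hv0 x) (hw0 x)
    nlinarith
  -- Passing through L_μ v, the error `e` from changing the measure is followed by the contraction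
  -- from v to w. Inverting returns to v and w, so minimality gives R ≤ e(1 + (1 - C⁻²)(R - 1)); the
  -- contraction absorbs R, and R ≤ C² on the right turns this into the constant 2C⁶.
  have hstep := hcmp.trans (hRb.integralOp_integralOp hk hK hμ hC hH hvc hwc hv0 hw0)
    (integralOp_pos hk hK hmix hvc hv0) (integralOp_pos hk hK hμ hvc hv0)
    (integralOp_pos hk hK hμ hwc hw0) (by linarith)
  have hinv := hstep.inv (integralOp_pos hk hK hmix hvc hv0) (integralOp_pos hk hK hμ hwc hw0)
  rw [← funext fun x => eq_inv_of_mul_eq_one_left (hv.mul_eq_one x),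
    ← funext fun x => eq_inv_of_mul_eq_one_left (hw.mul_eq_one x)] at hinv
  have hfin := hbest _ hinv
  have hd : 0 < (C ^ 2)⁻¹ := by positivity
  have h2 : (C ^ 2)⁻¹ * (R - 1) ≤ (e - 1) * R := by
    have : 0 ≤ (e - 1) * ((C ^ 2)⁻¹ * (R - 1)) :=
      mul_nonneg (by linarith) (mul_nonneg hd.le (by linarith))
    linarith
  rw [inv_mul_le_iff₀ (by positivity)] at h2
  have h3 : R ≤ 1 + 2 * C ^ 6 * ε := by
    have h4 : C ^ 2 * ((e - 1) * R) ≤ C ^ 2 * ((e - 1) * C ^ 2) := by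
      gcongr
    have h5 : C ^ 2 * ((e - 1) * C ^ 2) = 2 * C ^ 6 * ε := by
      rw [he]
      ring
    linarith
  intro x hx y hy
  exact (hRb x hx y hy).trans
    (mul_le_mul_of_nonneg_right h3 (mul_pos (hv0 _) (hw0 _)).le)

/-- Each scaling is used as a competitor in the maximisation problem of the other measure. The
summand 2C² comes from the defect of v as a competitor at μ, and 4C⁶ from twice the oscillation
bound on log(v/w). -/
theorem abs_integral_log_scaling_sub_le [IsProbabilityMeasure μ] [IsProbabilityMeasure ν]
    (hC : 1 ≤ C) (hH : HarnackOn K C k) (hk : IsScalingKernel k) (hK : IsCompact K)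
    (hμ : ∀ᵐ x ∂μ, x ∈ K) (hν : ∀ᵐ x ∂ν, x ∈ K) (h0 : 0 ≤ ε) (h1 : ε ≤ 1 / 2)
    (hv : IsScaling k (mixture μ ν ε) v) (hw : IsScaling k μ w) :
    |∫ x, Real.log (v x) ∂mixture μ ν ε - ∫ x, Real.log (w x) ∂μ
      - ε * (∫ x, Real.log (w x) ∂ν - ∫ x, Real.log (w x) ∂μ)|
      ≤ (4 * C ^ 6 + 2 * C ^ 2) * ε ^ 2 := by
  have hmix : ∀ᵐ x ∂mixture μ ν ε, x ∈ K := ae_mixture hμ hν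
  have h1' : ε ≤ 1 := h1.trans (by norm_num)
  have : IsProbabilityMeasure (mixture μ ν ε) := isProbabilityMeasure_mixture h0 h1'
  have hvc := hv.continuous
  have hwc := hw.continuous
  have hv0 := hv.pos
  have hw0 := hw.pos
  have hlv := hv.continuous_log
  have hlw := hw.continuous_log
  obtain ⟨z, hz⟩ : ∃ z, z ∈ K := hμ.exists
  have hop : ∀ {σ : Measure X} [IsProbabilityMeasure σ], (∀ᵐ x ∂σ, x ∈ K) → ∀ {f : X → ℝ},
      Continuous f → Continuous fun x => f x * integralOp k σ f x := fun hσ f hf =>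
    hf.mul (continuous_integralOp_of_continuous hk hK hσ hf)
  have hI : ∀ {σ : Measure X} [IsProbabilityMeasure σ], (∀ᵐ x ∂σ, x ∈ K) → ∀ {f : X → ℝ},
      Continuous f → Integrable f σ := fun hσ f hf => integrable_of_continuous hK hσ hf
  have hquad : ∀ f : X → ℝ, Continuous f →
      ∫ x, f x * integralOp k (mixture μ ν ε) f x ∂mixture μ ν ε
        = (1 - ε) ^ 2 * ∫ x, f x * integralOp k μ f x ∂μ
          + 2 * (ε * (1 - ε)) * ∫ x, f x * integralOp k μ f x ∂ν
          + ε ^ 2 * ∫ x, f x * integralOp k ν f x ∂ν := by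
    intro f hf
    have hcμ := hop hμ hf
    have hcν := hop hν hf
    rw [integral_mixture h0 h1' (hI hμ (hop hmix hf)) (hI hν (hop hmix hf))]
    have hexp : ∀ σ : Measure X, IsProbabilityMeasure σ → (∀ᵐ x ∂σ, x ∈ K) →
        ∫ x, f x * integralOp k (mixture μ ν ε) f x ∂σ
          = (1 - ε) * ∫ x, f x * integralOp k μ f x ∂σ
            + ε * ∫ x, f x * integralOp k ν f x ∂σ := by
      intro σ _ hσ
      rw [← integral_const_mul, ← integral_const_mul,
        ← integral_add ((hI hσ hcμ).const_mul _) ((hI hσ hcν).const_mul _)]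
      refine integral_congr_ae (Eventually.of_forall fun x => ?_)
      simp only [integralOp_mixture hk hK hμ hν hf h0 h1' x]
      ring
    rw [hexp μ ‹_› hμ, hexp ν ‹_› hν, integral_mul_integralOp_comm hk hK hμ hν hf hf]
    ring
  have hone : ∀ σ : Measure X, IsProbabilityMeasure σ →
      ∫ x, w x * integralOp k μ w x ∂σ = 1 := by
    intro σ _
    simp [hw.mul_eq_one]
  -- lower bound
  have hlow := hv.integral_log_ge hk hK hmix hwc hw0
  have hBw := hw.integral_mul_integralOp_le hC hH hk hK hμ hν
  rw [hquad w hwc, hone μ ‹_›, hone ν ‹_›,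
    integral_mixture h0 h1' (hI hμ hlw) (hI hν hlw)] at hlow
  -- upper bound
  have hupp := hw.integral_log_ge hk hK hμ hvc hv0
  have hBv := hv.integral_mul_integralOp_le hC hH hk hK hmix hν
  have hmixν : ∫ x, v x * integralOp k (mixture μ ν ε) v x ∂ν = 1 := by simp [hv.mul_eq_one]
  have hmixμ : ∫ x, v x * integralOp k (mixture μ ν ε) v x ∂mixture μ ν ε = 1 := by
    simp [hv.mul_eq_one]
  rw [hquad v hvc] at hmixμ
  have hν1 : (1 - ε) * ∫ x, v x * integralOp k μ v x ∂ν
      + ε * ∫ x, v x * integralOp k ν v x ∂ν = 1 := by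
    refine Eq.trans ?_ hmixν
    rw [← integral_const_mul, ← integral_const_mul,
      ← integral_add ((hI hν (hop hμ hvc)).const_mul _) ((hI hν (hop hν hvc)).const_mul _)]
    refine integral_congr_ae (Eventually.of_forall fun x => ?_)
    simp only [integralOp_mixture hk hK hμ hν hvc h0 h1' x]
    ring
  rw [integral_mixture h0 h1' (hI hμ hlv) (hI hν hlv)] at hlow ⊢
  have hrat := ratioBound_scaling_mixture hC hH hk hK hμ hν h0 h1 hv hw
  have hosc : ∀ σ : Measure X, IsProbabilityMeasure σ → (∀ᵐ x ∂σ, x ∈ K) →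
      |∫ x, Real.log (v x) ∂σ - ∫ x, Real.log (w x) ∂σ - Real.log (v z / w z)|
        ≤ 2 * C ^ 6 * ε := by
    intro σ _ hσ
    have h2 : ∫ x, Real.log (v x) ∂σ - ∫ x, Real.log (w x) ∂σ - Real.log (v z / w z)
        = ∫ x, (Real.log (v x / w x) - Real.log (v z / w z)) ∂σ := by
      rw [← integral_sub (hI hσ hlv) (hI hσ hlw)]
      have h3 : ∀ x, Real.log (v x / w x) = Real.log (v x) - Real.log (w x) := fun x =>
        Real.log_div (hv0 x).ne' (hw0 x).ne'
      rw [integral_sub _ (integrable_const _)]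
      · simp [h3]
      · simp only [h3]
        exact hI hσ (hlv.sub hlw)
    rw [h2, ← Real.norm_eq_abs]
    refine (norm_integral_le_of_norm_le_const (C := 2 * C ^ 6 * ε) ?_).trans_eq (by simp)
    filter_upwards [hσ] with x hx
    have h4 := hrat.abs_log_le hv0 hw0 hx hz
    rw [Real.norm_eq_abs]
    linarith
  have hoμ := abs_le.1 (hosc μ ‹_› hμ)
  have hoν := abs_le.1 (hosc ν ‹_› hν)
  generalize ∫ x, v x * integralOp k ν v x ∂ν = Bv at *
  generalize ∫ x, w x * integralOp k ν w x ∂ν = Bw at *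
  generalize ∫ x, v x * integralOp k μ v x ∂ν = Qv at *
  generalize ∫ x, v x * integralOp k μ v x ∂μ = Pv at *
  generalize ∫ x, Real.log (v x) ∂μ = lvμ at *
  generalize ∫ x, Real.log (v x) ∂ν = lvν at *
  generalize ∫ x, Real.log (w x) ∂μ = lwμ at *
  generalize ∫ x, Real.log (w x) ∂ν = lwν at *
  have hε2 := sq_nonneg ε
  have hCε := mul_nonneg (sq_nonneg C) hε2
  have hC6 : 0 ≤ C ^ 6 * ε ^ 2 := by positivity
  have hB1 := mul_le_mul_of_nonneg_left hBw hε2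
  have hB2 := mul_le_mul_of_nonneg_left hBv hε2
  -- The scaling equation of the mixture, integrated against the mixture and against ν, eliminates
  -- the cross term `Qv`, so the first-order part cancels. The 4 is 1/(1 - ε)² at ε = 1/2.
  have hPv : Pv - 1 ≤ 4 * (C ^ 2 * ε ^ 2) := by
    have h2 : (1 - ε) ^ 2 * (Pv - 1) = ε ^ 2 * (Bv - 1) := by
      linear_combination hmixμ - 2 * ε * hν1
    by_contra! hlt
    have h3 : 1 / 4 * (Pv - 1) ≤ (1 - ε) ^ 2 * (Pv - 1) := by
      refine mul_le_mul_of_nonneg_right ?_ (by linarith)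
      nlinarith
    linarith
  -- The unknown constant log(v z / w z) drops out because ν and μ have equal mass.
  have hosc' : ε * ((lvν - lwν) - (lvμ - lwμ)) ≤ ε * (4 * C ^ 6 * ε) :=
    mul_le_mul_of_nonneg_left (by linarith [hoν.2, hoμ.1]) h0
  rw [abs_le]
  constructor <;> linarith

theorem hasDerivWithinAt_integral_log_scaling [IsProbabilityMeasure μ] [IsProbabilityMeasure ν]
    (hk : IsScalingKernel k) (hK : IsCompact K) (hμ : ∀ᵐ x ∂μ, x ∈ K) (hν : ∀ᵐ x ∂ν, x ∈ K)
    (hw : IsScaling k μ w) {H : ℝ → ℝ}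
    (hH : ∀ ε, 0 ≤ ε → ε ≤ 1 → ∀ v, IsScaling k (mixture μ ν ε) v →
      H ε = ∫ x, Real.log (v x) ∂mixture μ ν ε) :
    HasDerivWithinAt H (∫ x, Real.log (w x) ∂ν - ∫ x, Real.log (w x) ∂μ) (Ici 0) 0 := by
  obtain ⟨C, hC, hCK⟩ := hk.exists_harnackOn hK
  refine hasDerivWithinAt_Ici_of_quadratic_bound (M := 4 * C ^ 6 + 2 * C ^ 2)
    (one_half_pos (α := ℝ)) fun ε h0 h1 => ?_
  have h1' : ε ≤ 1 := h1.trans (by norm_num)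
  have : IsProbabilityMeasure (mixture μ ν ε) := isProbabilityMeasure_mixture h0 h1'
  obtain ⟨v, hv⟩ := exists_isScaling hk hK (ae_mixture (ε := ε) hμ hν)
  have h2 : H 0 = ∫ x, Real.log (w x) ∂μ := by
    rw [hH 0 le_rfl zero_le_one w (by rwa [mixture_zero]), mixture_zero]
  rw [hH ε h0 h1' v hv, h2]
  exact abs_integral_log_scaling_sub_le hC hCK hk hK hμ hν h0 h1 hv hw

end Variation

/-! ### Gradients of Laplace transforms -/

section Laplace

variable {d : ℕ} {Y : Type*} [MeasurableSpace Y] {σ : Measure Y}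
  {b : Y → EuclideanSpace ℝ (Fin d)} {w : Y → ℝ}

/-- The norm is at most d times the largest coordinate in absolute value, and exp |s| ≤ exp s +
exp(-s). A Laplace transform finite everywhere therefore has all exponential moments; the summand 1
serves d = 0. -/
theorem exp_norm_le_sum (t : ℝ) (ht : 0 ≤ t) (v : EuclideanSpace ℝ (Fin d)) :
    Real.exp (t * ‖v‖) ≤ 1 + ∑ i : Fin d,
      (Real.exp (inner ℝ (EuclideanSpace.single i (t * d)) v)
        + Real.exp (inner ℝ (EuclideanSpace.single i (-(t * d))) v)) := by
  rcases isEmpty_or_nonempty (Fin d) with he | he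
  · simp [Subsingleton.elim v 0]
  obtain ⟨i, -, hi⟩ := Finset.exists_max_image Finset.univ (fun i => |v i|) Finset.univ_nonempty
  have h1 : ‖v‖ ≤ d * |v i| := by
    rw [EuclideanSpace.norm_eq]
    refine Real.sqrt_le_iff.2 ⟨by positivity, ?_⟩
    have h2 : ∑ j, ‖v j‖ ^ 2 ≤ ∑ _j : Fin d, |v i| ^ 2 := Finset.sum_le_sum fun j hj =>
      pow_le_pow_left₀ (norm_nonneg _) (hi j hj) 2
    have hd : (1 : ℝ) ≤ d := by
      have := Fin.pos_iff_nonempty.2 he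
      exact_mod_cast this
    rw [Finset.sum_const, Finset.card_univ, Fintype.card_fin, nsmul_eq_mul] at h2
    refine h2.trans ?_
    rw [mul_pow]
    exact mul_le_mul_of_nonneg_right (by nlinarith) (by positivity)
  have h3 : Real.exp (t * ‖v‖) ≤ Real.exp (inner ℝ (EuclideanSpace.single i (t * d)) v)
      + Real.exp (inner ℝ (EuclideanSpace.single i (-(t * d))) v) := by
    simp only [EuclideanSpace.inner_single_left, conj_trivial]
    have h4 : Real.exp (t * ‖v‖) ≤ Real.exp |t * d * v i| := by
      rw [abs_mul, abs_of_nonneg (by positivity : 0 ≤ t * d), mul_assoc]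
      gcongr
    rw [neg_mul]
    exact h4.trans (Real.exp_abs_le _)
  refine h3.trans ((Finset.single_le_sum (f := fun i : Fin d =>
      Real.exp (inner ℝ (EuclideanSpace.single i (t * d)) v)
        + Real.exp (inner ℝ (EuclideanSpace.single i (-(t * d))) v))
    (fun j _ => by positivity) (Finset.mem_univ i)).trans (le_add_of_nonneg_left zero_le_one))

theorem integrable_exp_norm_mul (hb : AEStronglyMeasurable b σ) (hw0 : ∀ y, 0 ≤ w y)
    (hint : ∀ z, Integrable (fun y => Real.exp (inner ℝ z (b y)) * w y) σ) (t : ℝ) (ht : 0 ≤ t)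
    (x : EuclideanSpace ℝ (Fin d)) :
    Integrable (fun y => Real.exp (t * ‖b y‖) * (Real.exp (inner ℝ x (b y)) * w y)) σ := by
  have h1 : Integrable (fun y => Real.exp (inner ℝ x (b y)) * w y + ∑ i : Fin d,
      (Real.exp (inner ℝ (x + EuclideanSpace.single i (t * d)) (b y)) * w y
        + Real.exp (inner ℝ (x + EuclideanSpace.single i (-(t * d))) (b y)) * w y)) σ :=
    (hint x).add (integrable_finsetSum _ fun i _ => (hint _).add (hint _))
  refine h1.mono' ?_ (Eventually.of_forall fun y => ?_)
  · exact (Real.continuous_exp.comp_aestronglyMeasurable (hb.norm.const_mul t)).mul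
      (hint x).aestronglyMeasurable
  · have h0 : 0 ≤ Real.exp (inner ℝ x (b y)) * w y := mul_nonneg (Real.exp_pos _).le (hw0 y)
    rw [Real.norm_of_nonneg (mul_nonneg (Real.exp_pos _).le h0)]
    refine (mul_le_mul_of_nonneg_right (exp_norm_le_sum t ht (b y)) h0).trans_eq ?_
    rw [add_mul, one_mul, Finset.sum_mul]
    congr 1
    refine Finset.sum_congr rfl fun i _ => ?_
    rw [inner_add_left, inner_add_left, Real.exp_add, Real.exp_add]
    ring

/-- One factor exp ‖b‖ pays for moving x by at most 1, the other absorbs the factor ‖b‖. The bound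
does not depend on z, as domination requires. -/
theorem norm_exp_smul_le (hw0 : ∀ y, 0 ≤ w y) {x z : EuclideanSpace ℝ (Fin d)}
    (hz : ‖z - x‖ ≤ 1) (y : Y) :
    ‖(Real.exp (inner ℝ z (b y)) * w y) • b y‖
      ≤ Real.exp (2 * ‖b y‖) * (Real.exp (inner ℝ x (b y)) * w y) := by
  have h1 : Real.exp (inner ℝ z (b y)) ≤ Real.exp (‖b y‖) * Real.exp (inner ℝ x (b y)) := by
    rw [← Real.exp_add, Real.exp_le_exp, ← sub_le_iff_le_add, ← inner_sub_left]
    refine (real_inner_le_norm _ _).trans ?_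
    exact mul_le_of_le_one_left (norm_nonneg _) hz
  have h2 : ‖b y‖ ≤ Real.exp ‖b y‖ := by linarith [Real.add_one_le_exp ‖b y‖]
  have hw := hw0 y
  rw [norm_smul, Real.norm_of_nonneg (by positivity), two_mul, Real.exp_add]
  calc Real.exp (inner ℝ z (b y)) * w y * ‖b y‖
      ≤ Real.exp ‖b y‖ * Real.exp (inner ℝ x (b y)) * w y * Real.exp ‖b y‖ := by gcongr
    _ = _ := by ring

theorem integrable_exp_smul (hb : AEStronglyMeasurable b σ) (hw0 : ∀ y, 0 ≤ w y)
    (hint : ∀ z, Integrable (fun y => Real.exp (inner ℝ z (b y)) * w y) σ)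
    (x : EuclideanSpace ℝ (Fin d)) :
    Integrable (fun y => (Real.exp (inner ℝ x (b y)) * w y) • b y) σ :=
  (integrable_exp_norm_mul hb hw0 hint 2 zero_le_two x).mono'
    ((hint x).aestronglyMeasurable.smul hb)
    (Eventually.of_forall (norm_exp_smul_le hw0 (by simp)))

theorem hasGradientAt_integral_exp (hb : AEStronglyMeasurable b σ) (hw0 : ∀ y, 0 ≤ w y)
    (hint : ∀ z, Integrable (fun y => Real.exp (inner ℝ z (b y)) * w y) σ)
    (x : EuclideanSpace ℝ (Fin d)) :
    HasGradientAt (fun z => ∫ y, Real.exp (inner ℝ z (b y)) * w y ∂σ)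
      (∫ y, (Real.exp (inner ℝ x (b y)) * w y) • b y ∂σ) x := by
  have hsm : ∀ z, AEStronglyMeasurable (fun y => innerSL ℝ
      ((Real.exp (inner ℝ z (b y)) * w y) • b y)) σ := fun z =>
    (innerSL ℝ).continuous.comp_aestronglyMeasurable ((hint z).aestronglyMeasurable.smul hb)
  have hbd := integrable_exp_norm_mul hb hw0 hint 2 zero_le_two x
  have hle : ∀ᵐ y ∂σ, ∀ z ∈ Metric.ball x 1,
      ‖innerSL ℝ ((Real.exp (inner ℝ z (b y)) * w y) • b y)‖
        ≤ Real.exp (2 * ‖b y‖) * (Real.exp (inner ℝ x (b y)) * w y) :=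
    Eventually.of_forall fun y z hz => by
      rw [innerSL_apply_norm]
      exact norm_exp_smul_le hw0 (mem_ball_iff_norm.1 hz).le y
  have hmain := hasFDerivAt_integral_of_dominated_of_fderiv_le (𝕜 := ℝ)
    (F' := fun z y => innerSL ℝ ((Real.exp (inner ℝ z (b y)) * w y) • b y))
    (Metric.ball_mem_nhds x one_pos) (Eventually.of_forall fun z => (hint z).aestronglyMeasurable)
    (hint x) (hsm x) hle hbd (Eventually.of_forall fun y z _ => by
      have h1 : HasFDerivAt (fun z : EuclideanSpace ℝ (Fin d) => (inner ℝ z (b y) : ℝ))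
          (innerSL ℝ (b y)) z := by
        have := (innerSL ℝ (b y)).hasFDerivAt (x := z)
        refine this.congr_of_eventuallyEq (Eventually.of_forall fun t => ?_)
        simp [real_inner_comm]
      have h2 := (h1.exp).mul_const (w y)
      refine h2.congr_fderiv ?_
      ext v
      simp
      ring)
  rw [hasGradientAt_iff_hasFDerivAt]
  refine hmain.congr_fderiv ?_
  have hF : Integrable (fun y => innerSL ℝ ((Real.exp (inner ℝ x (b y)) * w y) • b y)) σ :=
    hbd.mono' (hsm x) (hle.mono fun y h => h x (Metric.mem_ball_self one_pos))
  ext v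
  rw [ContinuousLinearMap.integral_apply hF]
  simp only [InnerProductSpace.toDual_apply_apply, innerSL_apply_apply]
  rw [real_inner_comm, ← integral_inner (integrable_exp_smul hb hw0 hint x)]
  simp only [real_inner_comm]

theorem hasGradientAt_log_integral_exp (hb : AEStronglyMeasurable b σ) (hw0 : ∀ y, 0 ≤ w y)
    (hint : ∀ z, Integrable (fun y => Real.exp (inner ℝ z (b y)) * w y) σ)
    (x : EuclideanSpace ℝ (Fin d)) (hpos : 0 < ∫ y, Real.exp (inner ℝ x (b y)) * w y ∂σ) :
    HasGradientAt (fun z => Real.log (∫ y, Real.exp (inner ℝ z (b y)) * w y ∂σ))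
      ((∫ y, Real.exp (inner ℝ x (b y)) * w y ∂σ)⁻¹ •
        ∫ y, (Real.exp (inner ℝ x (b y)) * w y) • b y ∂σ) x := by
  have h := (hasGradientAt_iff_hasFDerivAt.1 (hasGradientAt_integral_exp hb hw0 hint x)).log
    hpos.ne'
  rw [hasGradientAt_iff_hasFDerivAt]
  refine h.congr_fderiv ?_
  simp

end Laplace

/-! ### First variations and Wasserstein gradients -/

section Wasserstein

variable {d : ℕ} {F : Measure (EuclideanSpace ℝ (Fin d)) → ℝ}
  {μ : Measure (EuclideanSpace ℝ (Fin d))} {φ ψ : EuclideanSpace ℝ (Fin d) → ℝ}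
  {v w : EuclideanSpace ℝ (Fin d) → EuclideanSpace ℝ (Fin d)}

/-- Dirac masses are admissible perturbations, and one-sided derivatives are unique. -/
theorem HasFirstVariation.sub_integral_eq (hφ : HasFirstVariation F μ φ)
    (hψ : HasFirstVariation F μ ψ) (x : EuclideanSpace ℝ (Fin d)) :
    φ x - ∫ y, φ y ∂μ = ψ x - ∫ y, ψ y ∂μ := by
  have hc : CompactlySupported (Measure.dirac x) :=
    ⟨{x}, isCompact_singleton, by simp⟩
  have h1 := (hφ.2 (Measure.dirac x) inferInstance hc).2
  have h2 := (hψ.2 (Measure.dirac x) inferInstance hc).2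
  simp only [integral_dirac] at h1 h2
  exact (uniqueDiffWithinAt_Ici 0).eq_deriv _ h1 h2

theorem HasWassersteinGradient.unique (hv : HasWassersteinGradient F μ v)
    (hw : HasWassersteinGradient F μ w) : v = w := by
  obtain ⟨φ, hφ, hφv⟩ := hv
  obtain ⟨ψ, hψ, hψw⟩ := hw
  funext x
  have h : φ = fun x => ψ x + (∫ y, φ y ∂μ - ∫ y, ψ y ∂μ) := by
    funext x
    linarith [hφ.sub_integral_eq hψ x]
  have h1 : HasGradientAt φ (w x) x := by
    rw [h, hasGradientAt_iff_hasFDerivAt]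
    exact (hasGradientAt_iff_hasFDerivAt.1 (hψw x)).add_const _
  exact (hφv x).unique h1

theorem SolvesContinuityEquation.congr {τ : ℝ}
    {μ : ℝ → ProbabilityMeasure (EuclideanSpace ℝ (Fin d))}
    {v w : ℝ → EuclideanSpace ℝ (Fin d) → EuclideanSpace ℝ (Fin d)}
    (h : SolvesContinuityEquation τ μ v) (hvw : ∀ t ∈ Ico 0 τ, v t = w t) :
    SolvesContinuityEquation τ μ w := by
  have hmem : ∀ {t}, t ∈ Ico 0 τ → ∀ s ∈ uIcc 0 t, s ∈ Ico 0 τ := fun {t} ht s hs => by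
    rw [uIcc_of_le ht.1] at hs
    exact ⟨hs.1, hs.2.trans_lt ht.2⟩
  have hmem' : ∀ {t}, t ∈ Ico 0 τ → ∀ s ∈ uIoc 0 t, s ∈ Ico 0 τ := fun {t} ht s hs =>
    hmem ht s (uIoc_subset_uIcc hs)
  refine ⟨h.continuousOn, ?_, fun t ht => ?_, fun ψ hψ hψc t ht => ?_⟩
  · filter_upwards [h.integrable, ae_restrict_mem measurableSet_Ico] with t ht htm
    rwa [← hvw t htm]
  · refine (h.intervalIntegrable_norm t ht).congr fun s hs => ?_
    simp only [hvw s (hmem' ht s hs)]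
  · obtain ⟨h1, h2⟩ := h.weak ψ hψ hψc t ht
    refine ⟨h1.congr fun s hs => ?_, h2.trans (intervalIntegral.integral_congr fun s hs => ?_)⟩
    · simp only [hvw s (hmem' ht s hs)]
    · simp only [hvw s (hmem ht s hs)]

theorem solvesContinuityEquation_congr {τ : ℝ}
    {μ : ℝ → ProbabilityMeasure (EuclideanSpace ℝ (Fin d))}
    {v w : ℝ → EuclideanSpace ℝ (Fin d) → EuclideanSpace ℝ (Fin d)}
    (hvw : ∀ t ∈ Ico 0 τ, v t = w t) :
    SolvesContinuityEquation τ μ v ↔ SolvesContinuityEquation τ μ w :=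
  ⟨fun h => h.congr hvw, fun h => h.congr fun t ht => (hvw t ht).symm⟩

/-- Uniqueness of the gradient forces the velocity field hidden in the definition of a flow to equal
v at each time in [0, τ). -/
theorem solvesContinuityEquation_iff_isWassersteinGradientFlow {τ : ℝ}
    {μ : ℝ → ProbabilityMeasure (EuclideanSpace ℝ (Fin d))}
    {v : ℝ → EuclideanSpace ℝ (Fin d) → EuclideanSpace ℝ (Fin d)}
    (h : ∀ t ∈ Ico 0 τ, HasWassersteinGradient F (μ t) fun x => -v t x) :
    SolvesContinuityEquation τ μ v ↔ IsWassersteinGradientFlow F τ μ := by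
  refine ⟨fun hs => ⟨v, h, hs⟩, fun ⟨u, hu, hs⟩ => hs.congr fun t ht => ?_⟩
  funext x
  exact neg_injective (congrFun ((hu t ht).unique (h t ht)) x)

end Wasserstein

/-! ### The attention kernels -/

section Attention

variable {m d : ℕ} {WQ WK : Matrix (Fin m) (Fin d) ℝ} {WV : Matrix (Fin d) (Fin d) ℝ}
  {μ ν : Measure (EuclideanSpace ℝ (Fin d))} {w : EuclideanSpace ℝ (Fin d) → ℝ}

theorem cost_eq_inner (hV : WQ.transpose * WK = -WV) (x x' : EuclideanSpace ℝ (Fin d)) :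
    cost WQ WK x x' = inner ℝ x (-Matrix.toEuclideanLin WV x') := by
  have h := Matrix.toEuclideanLin_conjTranspose_eq_adjoint WQ
  rw [Matrix.conjTranspose_eq_transpose_of_trivial] at h
  rw [cost, ← LinearMap.adjoint_inner_right, ← h]
  congr 1
  have h2 : Matrix.toEuclideanLin (WQ.transpose * WK) x' = Matrix.toEuclideanLin (-WV) x' := by
    rw [hV]
  rw [map_neg, LinearMap.neg_apply] at h2
  rw [← h2]
  ext i
  simp [Matrix.toLpLin_apply, Matrix.mulVec_mulVec]

theorem kZero_eq (hV : WQ.transpose * WK = -WV) (x x' : EuclideanSpace ℝ (Fin d)) :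
    kZero WQ WK x x' = Real.exp (inner ℝ x (-Matrix.toEuclideanLin WV x')) := by
  rw [kZero, cost_eq_inner hV]

/-- Exchanging the arguments exchanges the two matrices, and both products of matrices equal -W_V.
-/
theorem cost_symm (hsymm : WK.transpose * WQ = WQ.transpose * WK)
    (hV : WQ.transpose * WK = -WV) (x x' : EuclideanSpace ℝ (Fin d)) :
    cost WQ WK x x' = cost WQ WK x' x := by
  have h : cost WQ WK x x' = cost WK WQ x' x := by
    rw [cost, cost, real_inner_comm]
  rw [h, cost_eq_inner (WV := WV) (hsymm.trans hV), cost_eq_inner hV]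

theorem isScalingKernel_kZero (hsymm : WK.transpose * WQ = WQ.transpose * WK)
    (hV : WQ.transpose * WK = -WV) : IsScalingKernel (kZero WQ WK) where
  continuous := by
    have hQ := (Matrix.toEuclideanLin WQ).continuous_of_finiteDimensional
    have hK := (Matrix.toEuclideanLin WK).continuous_of_finiteDimensional
    simp only [kZero, cost]
    fun_prop
  pos x y := Real.exp_pos _
  symm x y := by rw [kZero, kZero, cost_symm hsymm hV]

theorem continuous_neg_toEuclideanLin (A : Matrix (Fin d) (Fin d) ℝ) :
    Continuous fun y => -Matrix.toEuclideanLin A y :=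
  (Matrix.toEuclideanLin A).continuous_of_finiteDimensional.neg

theorem integrable_kZero_smul (hV : WQ.transpose * WK = -WV) (hw0 : ∀ y, 0 ≤ w y)
    (hint : ∀ z, Integrable (fun y => kZero WQ WK z y * w y) μ)
    (x : EuclideanSpace ℝ (Fin d)) :
    Integrable (fun y => (kZero WQ WK x y * w y) • Matrix.toEuclideanLin WV y) μ := by
  simp only [kZero_eq hV] at hint ⊢
  have h := integrable_exp_smul (continuous_neg_toEuclideanLin WV).aestronglyMeasurable hw0 hint x
  simpa using h.neg

theorem hasGradientAt_integral_kZero (hV : WQ.transpose * WK = -WV) (hw0 : ∀ y, 0 ≤ w y)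
    (hint : ∀ z, Integrable (fun y => kZero WQ WK z y * w y) μ)
    (x : EuclideanSpace ℝ (Fin d)) :
    HasGradientAt (fun z => ∫ y, kZero WQ WK z y * w y ∂μ)
      (-∫ y, (kZero WQ WK x y * w y) • Matrix.toEuclideanLin WV y ∂μ) x := by
  simp only [kZero_eq hV] at hint ⊢
  rw [← integral_neg]
  simpa using
    hasGradientAt_integral_exp (continuous_neg_toEuclideanLin WV).aestronglyMeasurable hw0 hint x

theorem hasGradientAt_log_integral_kZero (hV : WQ.transpose * WK = -WV) (hw0 : ∀ y, 0 ≤ w y)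
    (hint : ∀ z, Integrable (fun y => kZero WQ WK z y * w y) μ)
    (x : EuclideanSpace ℝ (Fin d)) (hpos : 0 < ∫ y, kZero WQ WK x y * w y ∂μ) :
    HasGradientAt (fun z => Real.log (∫ y, kZero WQ WK z y * w y ∂μ))
      (-((∫ y, kZero WQ WK x y * w y ∂μ)⁻¹ •
        ∫ y, (kZero WQ WK x y * w y) • Matrix.toEuclideanLin WV y ∂μ)) x := by
  simp only [kZero_eq hV] at hint hpos ⊢
  rw [← smul_neg, ← integral_neg]
  simpa using hasGradientAt_log_integral_exp
    (continuous_neg_toEuclideanLin WV).aestronglyMeasurable hw0 hint x hpos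

/-! ### The unnormalised kernel -/

theorem CompactlySupported.exists_ae_mem (h : CompactlySupported μ) :
    ∃ K : Set (EuclideanSpace ℝ (Fin d)), IsCompact K ∧ ∀ᵐ x ∂μ, x ∈ K := h

theorem continuous_integral_kZero (hV : WQ.transpose * WK = -WV)
    (hint : ∀ z, Integrable (fun y => kZero WQ WK z y) μ) :
    Continuous fun z => ∫ y, kZero WQ WK z y ∂μ := by
  refine continuous_iff_continuousAt.2 fun x => ?_
  have h := hasGradientAt_integral_kZero hV (w := fun _ => 1) (fun _ => zero_le_one)
    (by simpa using hint) x
  simpa using h.continuousAt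

/-- The inner integral is continuous, being differentiable as a Laplace transform, hence bounded on
the compact set that carries ν; no finite energy of μ is needed. -/
theorem integrable_kZero_prod [IsProbabilityMeasure μ] [IsProbabilityMeasure ν]
    (hsymm : WK.transpose * WQ = WQ.transpose * WK) (hV : WQ.transpose * WK = -WV)
    (hint : ∀ z, Integrable (fun y => kZero WQ WK z y) μ) (hν : CompactlySupported ν) :
    Integrable (fun p : EuclideanSpace ℝ (Fin d) × EuclideanSpace ℝ (Fin d) =>
      kZero WQ WK p.1 p.2) (ν.prod μ) := by
  have hk := isScalingKernel_kZero hsymm hV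
  obtain ⟨K, hK, hνK⟩ := hν.exists_ae_mem
  rw [integrable_prod_iff hk.continuous.aestronglyMeasurable]
  refine ⟨Eventually.of_forall hint, ?_⟩
  have h : ∀ x, ∫ y, ‖kZero WQ WK x y‖ ∂μ = ∫ y, kZero WQ WK x y ∂μ := fun x =>
    integral_congr_ae (Eventually.of_forall fun y => Real.norm_of_nonneg (hk.pos x y).le)
  simp only [h]
  exact integrable_of_continuous hK hνK (continuous_integral_kZero hV hint)

theorem hasFirstVariation_energyZero [IsProbabilityMeasure μ]
    (hsymm : WK.transpose * WQ = WQ.transpose * WK) (hV : WQ.transpose * WK = -WV)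
    (hμ : FiniteEnergyZero WQ WK μ) :
    HasFirstVariation (energyZero WQ WK) μ fun x => ∫ y, kZero WQ WK x y ∂μ := by
  have hk := isScalingKernel_kZero hsymm hV
  refine ⟨hμ.2.integral_prod_left, fun ν _ hν => ?_⟩
  have hνμ := integrable_kZero_prod hsymm hV hμ.1 hν
  obtain ⟨K, hK, hνK⟩ := hν.exists_ae_mem
  have hνν := integrable_prod_of_continuous hK hνK hνK hk.continuous
  refine ⟨hνμ.integral_prod_left, ?_⟩
  have hμν : Integrable (fun p : EuclideanSpace ℝ (Fin d) × EuclideanSpace ℝ (Fin d) =>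
      kZero WQ WK p.1 p.2) (μ.prod ν) := by
    have h := hνμ.swap
    refine h.congr (Eventually.of_forall fun p => ?_)
    exact hk.symm p.2 p.1
  set a := ∫ x, ∫ y, kZero WQ WK x y ∂μ ∂μ with ha
  set b := ∫ x, ∫ y, kZero WQ WK x y ∂μ ∂ν with hb
  set c := ∫ x, ∫ y, kZero WQ WK x y ∂ν ∂ν with hc
  have hb' : ∫ x, ∫ y, kZero WQ WK x y ∂ν ∂μ = b := by
    rw [hb, integral_integral_swap (f := fun x y => kZero WQ WK x y) hμν]
    simp only [hk.symm]
  have hmix : ∀ ε, 0 ≤ ε → ε ≤ 1 → energyZero WQ WK (mixture μ ν ε)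
      = 1 / 2 * ((1 - ε) ^ 2 * a + 2 * (ε * (1 - ε)) * b + ε ^ 2 * c) := by
    intro ε h0 h1
    have := isProbabilityMeasure_mixture (μ := μ) (ν := ν) h0 h1
    have hprod : (mixture μ ν ε).prod (mixture μ ν ε)
        = ENNReal.ofReal (1 - ε) • ENNReal.ofReal (1 - ε) • μ.prod μ
          + ENNReal.ofReal ε • ENNReal.ofReal (1 - ε) • μ.prod ν
          + (ENNReal.ofReal (1 - ε) • ENNReal.ofReal ε • ν.prod μ
          + ENNReal.ofReal ε • ENNReal.ofReal ε • ν.prod ν) := by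
      have hs : SFinite (mixture μ ν ε) := inferInstance
      rw [mixture] at hs
      rw [mixture, Measure.add_prod, Measure.prod_add, Measure.prod_add]
      simp only [Measure.prod_smul_left, Measure.prod_smul_right]
    have hf : ∀ e : ℝ, ENNReal.ofReal e ≠ ⊤ := fun e => ENNReal.ofReal_ne_top
    have h1' : 0 ≤ 1 - ε := by linarith
    rw [energyZero, hprod, integral_add_measure, integral_add_measure, integral_add_measure]
    · simp only [integral_smul_measure, ENNReal.toReal_ofReal h0, ENNReal.toReal_ofReal h1',
        integral_prod _ hμ.2, integral_prod _ hμν, integral_prod _ hνμ, integral_prod _ hνν,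
        hb', ← ha, ← hb, ← hc, smul_eq_mul]
      ring
    · exact (hνμ.smul_measure (hf _)).smul_measure (hf _)
    · exact (hνν.smul_measure (hf _)).smul_measure (hf _)
    · exact (hμ.2.smul_measure (hf _)).smul_measure (hf _)
    · exact (hμν.smul_measure (hf _)).smul_measure (hf _)
    · exact ((hμ.2.smul_measure (hf _)).smul_measure (hf _)).add_measure
        ((hμν.smul_measure (hf _)).smul_measure (hf _))
    · exact ((hνμ.smul_measure (hf _)).smul_measure (hf _)).add_measure
        ((hνν.smul_measure (hf _)).smul_measure (hf _))
  -- The energy is a quadratic polynomial in ε with slope b - a at 0 and leading coefficient (a - 2b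
  -- + c)/2.
  refine hasDerivWithinAt_Ici_of_quadratic_bound (M := |1 / 2 * (a - 2 * b + c)|) one_pos
    fun ε h0 h1 => ?_
  change |energyZero WQ WK (mixture μ ν ε) - energyZero WQ WK (mixture μ ν 0) - _| ≤ _
  rw [hmix ε h0 h1, hmix 0 le_rfl zero_le_one, ← abs_of_nonneg (sq_nonneg ε), ← abs_mul]
  refine le_of_eq (congrArg _ ?_)
  rw [abs_of_nonneg (sq_nonneg ε)]
  ring

theorem hasWassersteinGradient_energyZero [IsProbabilityMeasure μ]
    (hsymm : WK.transpose * WQ = WQ.transpose * WK) (hV : WQ.transpose * WK = -WV)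
    (hμ : FiniteEnergyZero WQ WK μ) :
    HasWassersteinGradient (energyZero WQ WK) μ fun x => -attentionMap WV (kZero WQ WK) μ x := by
  refine ⟨_, hasFirstVariation_energyZero hsymm hV hμ, fun x => ?_⟩
  simpa [attentionMap] using hasGradientAt_integral_kZero hV (w := fun _ => 1)
    (fun _ => zero_le_one) (by simpa using hμ.1) x

theorem attentionConverges_kZero (hV : WQ.transpose * WK = -WV)
    (hint : ∀ z, Integrable (fun y => kZero WQ WK z y) μ) :
    AttentionConverges WV (kZero WQ WK) μ := fun x => by
  simpa using integrable_kZero_smul hV (w := fun _ => 1) (fun _ => zero_le_one)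
    (by simpa using hint) x

/-! ### The SoftMax kernel -/

theorem kOne_smul (x x' y : EuclideanSpace ℝ (Fin d)) :
    kOne WQ WK μ x x' • y = (∫ z, kZero WQ WK x z ∂μ)⁻¹ • kZero WQ WK x x' • y := by
  rw [kOne, softMaxKernel, div_eq_inv_mul, mul_smul]

theorem attentionConverges_kOne (hV : WQ.transpose * WK = -WV)
    (hint : ∀ z, Integrable (fun y => kZero WQ WK z y) μ) :
    AttentionConverges WV (kOne WQ WK μ) μ := fun x => by
  simp only [kOne_smul]
  exact (attentionConverges_kZero hV hint x).smul (∫ z, kZero WQ WK x z ∂μ)⁻¹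

theorem hasGradientAt_log_integral_kOne [IsProbabilityMeasure μ] (hV : WQ.transpose * WK = -WV)
    (hint : ∀ z, Integrable (fun y => kZero WQ WK z y) μ) (x : EuclideanSpace ℝ (Fin d)) :
    HasGradientAt (fun z => Real.log (∫ x', kZero WQ WK z x' ∂μ))
      (-attentionMap WV (kOne WQ WK μ) μ x) x := by
  have hpos : 0 < ∫ y, kZero WQ WK x y ∂μ :=
    integral_pos_of_ae_pos (Eventually.of_forall fun y => Real.exp_pos _) (hint x)
  have h := hasGradientAt_log_integral_kZero hV (w := fun _ => 1) (fun _ => zero_le_one)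
    (by simpa using hint) x (by simpa using hpos)
  simp only [mul_one] at h
  simpa only [attentionMap, kOne_smul, integral_smul] using h

/-! ### The Sinkhorn kernel -/

theorem energyInf_eq [IsProbabilityMeasure μ] {K : Set (EuclideanSpace ℝ (Fin d))}
    (hk : IsScalingKernel (kZero WQ WK)) (hK : IsCompact K) (hμ : ∀ᵐ x ∂μ, x ∈ K)
    (hw : IsScaling (kZero WQ WK) μ w) :
    Integrable (entropyDensity WQ WK μ) (μ.prod μ) ∧
      energyInf WQ WK μ = -∫ x, Real.log (w x) ∂μ := by
  have h : entropyDensity WQ WK μ = fun p => kZero WQ WK p.1 p.2 * (w p.1 * w p.2) *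
      Real.log (kZero WQ WK p.1 p.2 * (w p.1 * w p.2) / kZero WQ WK p.1 p.2) := by
    funext p
    rw [entropyDensity, kInf, sinkhornKernel_eq hk hK hμ hw]
  obtain ⟨h1, h2⟩ := integral_scaling_entropy hk hK hμ hw
  rw [energyInf, h, h2]
  exact ⟨h1, by ring⟩

theorem hasFirstVariation_energyInf [IsProbabilityMeasure μ]
    (hk : IsScalingKernel (kZero WQ WK)) (hμ : CompactlySupported μ)
    (hw : IsScaling (kZero WQ WK) μ w) :
    HasFirstVariation (energyInf WQ WK) μ fun x => -Real.log (w x) := by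
  obtain ⟨K, hK, hμK⟩ := hμ.exists_ae_mem
  have hlog := hw.continuous_log.neg
  refine ⟨integrable_of_continuous hK hμK hlog, fun ν _ hν => ?_⟩
  obtain ⟨K', hK', hνK'⟩ := hν.exists_ae_mem
  refine ⟨integrable_of_continuous hK' hνK' hlog, ?_⟩
  -- The compact set must carry both measures. The scaling `w` need not be changed, since its
  -- equation holds on the whole space.
  have hU := hK.union hK'
  have hμU : ∀ᵐ x ∂μ, x ∈ K ∪ K' := hμK.mono fun x hx => Or.inl hx
  have hνU : ∀ᵐ x ∂ν, x ∈ K ∪ K' := hνK'.mono fun x hx => Or.inr hx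
  have h := (hasDerivWithinAt_integral_log_scaling hk hU hμU hνU hw
    (H := fun ε => -energyInf WQ WK (mixture μ ν ε)) fun ε h0 h1 v hv => by
      have := isProbabilityMeasure_mixture (μ := μ) (ν := ν) h0 h1
      rw [(energyInf_eq hk hU (ae_mixture hμU hνU) hv).2, neg_neg]).neg
  rw [integral_neg, integral_neg, ← neg_sub']
  refine h.congr_of_eventuallyEq (Eventually.of_forall fun ε => ?_) ?_
  all_goals simp [mixture]

/-- The kernel factorises through `w`, and 1/w = L_μ w presents -log w as the logarithm of a
weighted Laplace transform, whose gradient is the negative of the attention map. -/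
theorem attentionMap_kInf [IsProbabilityMeasure μ]
    (hsymm : WK.transpose * WQ = WQ.transpose * WK) (hV : WQ.transpose * WK = -WV)
    (hμ : CompactlySupported μ) :
    AttentionConverges WV (kInf WQ WK μ) μ ∧
      HasWassersteinGradient (energyInf WQ WK) μ
        fun x => -attentionMap WV (kInf WQ WK μ) μ x := by
  have hk := isScalingKernel_kZero hsymm hV
  obtain ⟨K, hK, hμK⟩ := hμ.exists_ae_mem
  obtain ⟨w, hw⟩ := exists_isScaling hk hK hμK
  have hint : ∀ z, Integrable (fun y => kZero WQ WK z y * w y) μ := fun z =>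
    integrable_kernel_mul hk hK hμK hw.continuous z
  have hw0 : ∀ y, 0 ≤ w y := fun y => (hw.pos y).le
  have hsmul : ∀ x x' y : EuclideanSpace ℝ (Fin d), kInf WQ WK μ x x' • y = w x • (kZero WQ WK x x' * w x') • y := by
    intro x x' y
    rw [kInf, sinkhornKernel_eq hk hK hμK hw, smul_smul]
    congr 1
    ring
  refine ⟨fun x => ?_, fun x => -Real.log (w x), hasFirstVariation_energyInf hk hμ hw, fun x => ?_⟩
  · simp only [hsmul]
    exact (integrable_kZero_smul hV hw0 hint x).smul (w x)
  · have hinv : ∀ z, ∫ y, kZero WQ WK z y * w y ∂μ = (w z)⁻¹ := fun z =>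
      eq_inv_of_mul_eq_one_right (hw.mul_eq_one z)
    have h := hasGradientAt_log_integral_kZero hV hw0 hint x
      (by rw [hinv]; exact inv_pos.2 (hw.pos x))
    simp only [hinv, Real.log_inv, inv_inv] at h
    simpa only [attentionMap, hsmul, integral_smul] using h

theorem tendsto_sinkhornIter_kInf [IsProbabilityMeasure μ]
    (hsymm : WK.transpose * WQ = WQ.transpose * WK) (hV : WQ.transpose * WK = -WV)
    (hμ : CompactlySupported μ) (x x' : EuclideanSpace ℝ (Fin d)) :
    Tendsto (fun l => sinkhornIter (kZero WQ WK) μ l x x') atTop (𝓝 (kInf WQ WK μ x x')) := by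
  have hk := isScalingKernel_kZero hsymm hV
  obtain ⟨K, hK, hμK⟩ := hμ.exists_ae_mem
  obtain ⟨w, hw⟩ := exists_isScaling hk hK hμK
  rw [kInf, sinkhornKernel_eq hk hK hμK hw]
  exact tendsto_sinkhornIter hk hK hμK hw x x'

theorem integrable_entropyDensity [IsProbabilityMeasure μ]
    (hsymm : WK.transpose * WQ = WQ.transpose * WK) (hV : WQ.transpose * WK = -WV)
    (hμ : CompactlySupported μ) : Integrable (entropyDensity WQ WK μ) (μ.prod μ) := by
  have hk := isScalingKernel_kZero hsymm hV
  obtain ⟨K, hK, hμK⟩ := hμ.exists_ae_mem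
  obtain ⟨w, hw⟩ := exists_isScaling hk hK hμK
  exact (energyInf_eq hk hK hμK hw).1

end Attention

end Sinkformer

/-! ### The three statements assembled. -/

theorem proposition2 {m d : ℕ} (WQ WK : Matrix (Fin m) (Fin d) ℝ) (WV : Matrix (Fin d) (Fin d) ℝ)
    (hsymm : WK.transpose * WQ = WQ.transpose * WK) (hV : WQ.transpose * WK = -WV) :
    -- the unnormalised kernel
    ((∀ μ : Measure (EuclideanSpace ℝ (Fin d)), IsProbabilityMeasure μ →
        FiniteEnergyZero WQ WK μ →
        AttentionConverges WV (kZero WQ WK) μ ∧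
        HasWassersteinGradient (energyZero WQ WK) μ
          (fun x => -attentionMap WV (kZero WQ WK) μ x)) ∧
      (∀ (τ : ℝ) (μ : ℝ → ProbabilityMeasure (EuclideanSpace ℝ (Fin d))),
        (∀ t ∈ Ico 0 τ, FiniteEnergyZero WQ WK (μ t)) →
        (SolvesContinuityEquation τ μ (fun t => attentionMap WV (kZero WQ WK) (μ t)) ↔
          IsWassersteinGradientFlow (energyZero WQ WK) τ μ))) ∧
    -- the SoftMax kernel
    ((∀ μ : Measure (EuclideanSpace ℝ (Fin d)), IsProbabilityMeasure μ →
        (∀ x, Integrable (fun x' => kZero WQ WK x x') μ) →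
        AttentionConverges WV (kOne WQ WK μ) μ ∧
        ∀ x, HasGradientAt (fun z => Real.log (∫ x', kZero WQ WK z x' ∂μ))
          (-attentionMap WV (kOne WQ WK μ) μ x) x) ∧
      (∀ (τ : ℝ) (μ : ℝ → ProbabilityMeasure (EuclideanSpace ℝ (Fin d))),
        (∀ t ∈ Ico 0 τ, ∀ x, Integrable (fun x' => kZero WQ WK x x')
          (μ t : Measure (EuclideanSpace ℝ (Fin d)))) →
        (SolvesContinuityEquation τ μ (fun t => attentionMap WV (kOne WQ WK (μ t)) (μ t)) ↔
          SolvesContinuityEquation τ μ (fun t x =>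
            -(∇ (fun z => Real.log (∫ x', kZero WQ WK z x'
              ∂(μ t : Measure (EuclideanSpace ℝ (Fin d))))) x))))) ∧
    -- the Sinkhorn kernel
    ((∀ μ : Measure (EuclideanSpace ℝ (Fin d)), IsProbabilityMeasure μ →
        CompactlySupported μ →
        (∀ x x', Tendsto (fun l => sinkhornIter (kZero WQ WK) μ l x x') atTop
          (𝓝 (kInf WQ WK μ x x'))) ∧
        AttentionConverges WV (kInf WQ WK μ) μ ∧
        Integrable (entropyDensity WQ WK μ) (μ.prod μ) ∧
        HasWassersteinGradient (energyInf WQ WK) μ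
          (fun x => -attentionMap WV (kInf WQ WK μ) μ x)) ∧
      (∀ (τ : ℝ) (μ : ℝ → ProbabilityMeasure (EuclideanSpace ℝ (Fin d))),
        (∀ t ∈ Ico 0 τ, CompactlySupported (μ t : Measure (EuclideanSpace ℝ (Fin d)))) →
        (SolvesContinuityEquation τ μ (fun t => attentionMap WV (kInf WQ WK (μ t)) (μ t)) ↔
          IsWassersteinGradientFlow (energyInf WQ WK) τ μ))) := by
  refine ⟨⟨fun μ _ hμ => ⟨attentionConverges_kZero hV hμ.1,
      hasWassersteinGradient_energyZero hsymm hV hμ⟩, fun τ μ hμ =>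
      solvesContinuityEquation_iff_isWassersteinGradientFlow fun t ht =>
        hasWassersteinGradient_energyZero hsymm hV (hμ t ht)⟩,
    ⟨fun μ _ hμ => ⟨attentionConverges_kOne hV hμ, hasGradientAt_log_integral_kOne hV hμ⟩,
      fun τ μ hμ => solvesContinuityEquation_congr fun t ht => ?_⟩,
    ⟨fun μ _ hμ => ⟨tendsto_sinkhornIter_kInf hsymm hV hμ, (attentionMap_kInf hsymm hV hμ).1,
      integrable_entropyDensity hsymm hV hμ, (attentionMap_kInf hsymm hV hμ).2⟩, fun τ μ hμ =>
      solvesContinuityEquation_iff_isWassersteinGradientFlow fun t ht =>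
        (attentionMap_kInf hsymm hV (hμ t ht)).2⟩⟩
  funext x
  rw [(hasGradientAt_log_integral_kOne hV (hμ t ht) x).gradient, neg_neg]
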